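/- Let $t_0<T$, let $n$ be a non-negative integer, $1\le p<+\infty$ and $\frac1p+\frac1q=1$. Let $L_r^n=L_r([t_0,T];\mathbb R^n)$ (Lebesgue measure, $1\le r\le\infty$), let $C^n=C([t_0,T];\mathbb R^n)$ carry the supremum norm, and let $(\cdot\,|\,\cdot)$ and $|\cdot|$ be the Euclidean inner product and norm of $\mathbb R^n$. Let $f:[t_0,T]\times\mathbb R^n\to\mathbb R\cup\{+\infty\}$ be a normal convex integrand, i.e. for every $t$ the epigraph $\operatorname{epi} f_t=\{(z,\alpha)\in\mathbb R^n\times\mathbb R: f(t,z)\le\alpha\}$ is closed and convex, and the multivalued map $t\mapsto\operatorname{epi} f_t$ is Lebesgue measurable (for every open $U\subset\mathbb R^n\times\mathbb R$ the set $\{t:\operatorname{epi} f_t\cap U\ne\emptyset\}$ is Lebesgue measurable). Let $A:L_p^n\to C^n$ be a linear, continuous and compact operator, let $\bar u\in L_p^n$ and $\bar x=A\bar u$, and suppose that there is $\delta>0$ such that for every $x\in\mathbb R^n$ with $|x|\le\delta$ the function $t\mapsto f(t,\bar x(t)+x)$ is summable (i.e. almost everywhere finite and equal to a Lebesgue integrable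 function). Put $$J(u)=\int_{t_0}^T f(t,(Au)(t))\,dt,\qquad u\in L_p^n,$$ where the integral of an extended real-valued function $g$ is $\int g^+-\int g^-$, read as $+\infty$ whenever $\int g^+=+\infty$. Let $\partial J(\bar u)$ be the set of all $y^*\in L_q^n$ such that $$J(u)-J(\bar u)\ \ge\ \int_{t_0}^T (y^*(t)\,|\,u(t)-\bar u(t))\,dt\qquad\text{for all }u\in L_p^n,$$ $J(\bar u)$ being finite, and let $\partial f(t,\bar x(t))\subset\mathbb R^n$ be the subdifferential of the convex function $f(t,\cdot)$ at $\bar x(t)$, i.e. the set of all $w\in\mathbb R^n$ with $f(t,z)-f(t,\bar x(t))\ge(w\,|\,z-\bar x(t))$ for all $z\in\mathbb R^n$, $f(t,\bar x(t))$ being finite. Then: 1. $\partial J(\bar u)$ is nonempty; 2. $y^*\in L_q^n$ belongs to $\partial J(\bar u)$ if and only if there is $u^*\in L_1^n$ with $u^*(t)\in\partial f(t,\bar x(t))$ for almost every $t\in[t_0,T]$ and $y^*=A^*u^*$, i.e. $$\int_{t_0}^T (y^*(t)\,|\,v(t))\,dt=\int_{t_0}^T (u^*(t)\,|\,(Av)(t))\,dt\qquad\text{for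 all }v\in L_p^n.$$ -/

import Mathlib

open MeasureTheory

/-- `ℝⁿ` with the Euclidean norm. -/
abbrev RVec (n : ℕ) : Type := EuclideanSpace ℝ (Fin n)

/-- Lebesgue measure on the interval `[t₀, T]`. -/
noncomputable abbrev lebIcc (t₀ T : ℝ) : Measure (Set.Icc t₀ T) :=
  Measure.comap Subtype.val volume

/-- The space `L_pⁿ[t₀, T]` (with respect to Lebesgue measure on `[t₀, T]`). -/
abbrev LpVec (n : ℕ) (t₀ T : ℝ) (p : ENNReal) : Type :=
  ↥(Lp (RVec n) p (lebIcc t₀ T))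

/-- The space `Cⁿ[t₀, T]` (with the supremum norm). -/
abbrev CVec (n : ℕ) (t₀ T : ℝ) : Type := C(Set.Icc t₀ T, RVec n)

/-- The epigraph `{(z, α) ∈ E × ℝ : g z ≤ α}` of an extended real-valued function. -/
def epigraph {E : Type*} (g : E → EReal) : Set (E × ℝ) :=
  {w | g w.1 ≤ (w.2 : EReal)}

/-- `f : [t₀, T] × ℝⁿ → ℝ ∪ {+∞}` is a normal convex integrand: every epigraph `epi f_t` is closed
and convex, and the closed-valued multifunction `t ↦ epi f_t` is (Lebesgue) measurable, i.e. the
set of those `t` for which `epi f_t` meets `U` is Lebesgue measurable for every open `U`. -/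
structure IsNormalConvexIntegrand {n : ℕ} {t₀ T : ℝ}
    (f : Set.Icc t₀ T → RVec n → EReal) : Prop where
  ne_bot : ∀ t x, f t x ≠ ⊥
  isClosed_epigraph : ∀ t, IsClosed (epigraph (f t))
  convex_epigraph : ∀ t, Convex ℝ (epigraph (f t))
  measurable_epigraph : ∀ U : Set (RVec n × ℝ), IsOpen U →
    NullMeasurableSet {t | (epigraph (f t) ∩ U).Nonempty} (lebIcc t₀ T)

/-- An extended real-valued function is summable if it is almost everywhere finite and equal to
a Lebesgue integrable real function. -/
def IsSummable {α : Type*} [MeasurableSpace α] (μ : Measure α) (g : α → EReal) : Prop :=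
  ∃ h : α → ℝ, Integrable h μ ∧ ∀ᵐ t ∂μ, g t = (h t : EReal)

open scoped Classical in
/-- The integral `∫ g⁺ - ∫ g⁻ ∈ ℝ ∪ {±∞}` of an extended real-valued function, with the convention
of convex analysis that it is `+∞` as soon as `∫ g⁺ = +∞`. -/
noncomputable def extIntegral {α : Type*} [MeasurableSpace α] (μ : Measure α) (g : α → EReal) :
    EReal :=
  if ∫⁻ t, (g t).toENNReal ∂μ = ⊤ then ⊤
  else ((∫⁻ t, (g t).toENNReal ∂μ : ENNReal) : EReal) -
    ((∫⁻ t, (-g t).toENNReal ∂μ : ENNReal) : EReal)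

/-- The integral functional `J(u) = ∫_{t₀}^T f(t, (Au)(t)) dt` on `L_pⁿ[t₀, T]`. -/
noncomputable def integralFunctional {n : ℕ} {t₀ T : ℝ} {p : ENNReal} [Fact (1 ≤ p)]
    (f : Set.Icc t₀ T → RVec n → EReal) (A : LpVec n t₀ T p →L[ℝ] CVec n t₀ T)
    (u : LpVec n t₀ T p) : EReal :=
  extIntegral (lebIcc t₀ T) fun t => f t (A u t)

/-- The subdifferential at `x₀` of `F : X → ℝ ∪ {±∞}`, with respect to a pairing
`B : Y × X → ℝ`: the set of `y ∈ Y` with `F x - F x₀ ≥ B(y, x - x₀)` for all `x`, where `F x₀` has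
to be finite. -/
def subdifferential {X Y : Type*} [AddCommGroup X] (B : Y → X → ℝ) (F : X → EReal) (x₀ : X) :
    Set Y :=
  {y | F x₀ ≠ ⊥ ∧ F x₀ ≠ ⊤ ∧ ∀ x, F x₀ + (B y (x - x₀) : EReal) ≤ F x}

/-- The pairing `⟨v, u⟩ = ∫_{t₀}^T (v(t) | u(t)) dt` of `L_qⁿ[t₀, T]` and `L_pⁿ[t₀, T]`. -/
noncomputable def lpPair {n : ℕ} {t₀ T : ℝ} {p q : ENNReal}
    (v : LpVec n t₀ T q) (u : LpVec n t₀ T p) : ℝ :=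
  ∫ t, inner ℝ (v t) (u t) ∂lebIcc t₀ T

/-- `y = A*u*`, where `A* : Cⁿ[t₀, T]* → L_pⁿ[t₀, T]* = L_qⁿ[t₀, T]` is the adjoint of `A` and
`u* ∈ L₁ⁿ[t₀, T]` is regarded as the functional `x ↦ ∫ (u*(t) | x(t)) dt` on `Cⁿ[t₀, T]`:
`∫ (y(t) | v(t)) dt = ∫ (u*(t) | (Av)(t)) dt` for all `v ∈ L_pⁿ[t₀, T]`. -/
def IsAdjointImage {n : ℕ} {t₀ T : ℝ} {p q : ENNReal} [Fact (1 ≤ p)]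
    (A : LpVec n t₀ T p →L[ℝ] CVec n t₀ T) (u : LpVec n t₀ T 1) (y : LpVec n t₀ T q) : Prop :=
  ∀ v : LpVec n t₀ T p, lpPair y v = ∫ t, inner ℝ (u t) (A v t) ∂lebIcc t₀ T

/-! Convexity together with summability at the finitely many points `x̄(t)` and `x̄(t) ± δ eᵢ` gives
the increment of `f(t,·)` at `x̄(t)` linear growth near 0 with an integrable constant `K(t)`
(`ae_abs_integrandIncrement_le`). Its directional derivative `g_t` is therefore sublinear with
`|g_t(z)| ≤ K(t)|z|`, and dominated convergence shows that `y* ∈ ∂J(ū)` forces `⟨y*, v⟩ ≤ ∫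
g_t(Av(t)) dt` (`le_integral_dirDerivZero`).

The core is `exists_integrable_selection_of_le_integral`. Extending by Hahn–Banach to bounded
functions could produce singular functionals, so the problem is moved to `L₂`. With `k = √(|K| +
1)`, homogeneity gives `∫ g_t(Av) = N(kAv)`, where `N(ξ) = ∫ k⁻¹ g_t(ξ)` is bounded on `L₂`. A
dominated extension is represented by some `w ∈ L₂`, and `u* = kw ∈ L₁`. Testing on indicators gives
`(u*(t)|z) ≤ g_t(z)`, hence `u*(t) ∈ ∂f(t, x̄(t))`.

Conversely, the pointwise subgradient inequality is integrated. For nonemptiness, the selection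
result with zero data yields some `u*`, and the duality of `L_p` and `L_q`, obtained from
Radon–Nikodym, yields `y* = A*u*`. -/

section RieszRepresentation

/-! ### Densities of functionals on `L_p` -/

open Filter Topology

variable {α : Type*} [MeasurableSpace α] {μ : Measure α} [IsFiniteMeasure μ]

/-- The measures of the finite partial unions of a disjoint sequence exhaust the whole union. -/
lemma tendsto_measure_symmDiff_biUnion {s : ℕ → Set α} (hs : ∀ i, MeasurableSet (s i))
    (hd : Pairwise (Function.onFun Disjoint s)) :
    Tendsto (fun b : Finset ℕ => μ (symmDiff (⋃ i ∈ b, s i) (⋃ i, s i))) atTop (𝓝 0) := by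
  have h1 : ∀ b : Finset ℕ, μ (symmDiff (⋃ i ∈ b, s i) (⋃ i, s i))
      = μ (⋃ i, s i) - ∑ i ∈ b, μ (s i) := by
    intro b
    have hsub : (⋃ i ∈ b, s i) ⊆ ⋃ i, s i := Set.iUnion₂_subset fun i _ => Set.subset_iUnion s i
    rw [Set.symmDiff_def, Set.sdiff_eq_empty.2 hsub, Set.empty_union,
      measure_sdiff hsub (Finset.measurableSet_biUnion b fun i _ => hs i).nullMeasurableSet
        (measure_ne_top _ _),
      measure_biUnion_finset (fun i _ j _ hij => hd hij) fun i _ => hs i]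
  simp_rw [h1]
  have h2 : Tendsto (fun b : Finset ℕ => ∑ i ∈ b, μ (s i)) atTop (𝓝 (μ (⋃ i, s i))) := by
    rw [measure_iUnion hd hs]
    exact ENNReal.summable.hasSum
  simpa using ENNReal.Tendsto.sub (tendsto_const_nhds (x := μ (⋃ i, s i))) h2
    (Or.inl (measure_ne_top _ _))

open scoped Classical in
/-- The signed measure `s ↦ φ(1_s)` defined by a continuous linear functional on `L_p`. -/
noncomputable def signedMeasureOfDual {p : ENNReal} [Fact (1 ≤ p)] (hp : p ≠ ⊤)
    (φ : Lp ℝ p μ →L[ℝ] ℝ) : SignedMeasure α where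
  measureOf' s := if hs : MeasurableSet s then
    φ (indicatorConstLp p hs (measure_ne_top μ s) 1) else 0
  empty' := by simp [indicatorConstLp_empty]
  not_measurable' s hs := by simp [hs]
  m_iUnion' s hs hd := by
    have hU : MeasurableSet (⋃ i, s i) := MeasurableSet.iUnion hs
    simp only [hs, hU, dif_pos]
    have hb : ∀ b : Finset ℕ, MeasurableSet (⋃ i ∈ b, s i) :=
      fun b => Finset.measurableSet_biUnion b fun i _ => hs i
    -- Countable additivity is continuity of `φ`: for `p < ∞`, indicators converge in `L_p` once the
    -- symmetric differences shrink to measure zero.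
    have key := (φ.continuous.tendsto _).comp (tendsto_indicatorConstLp_set (p := p) (μ := μ)
      (E := ℝ) (c := 1) (hs := hU) (hμs := measure_ne_top _ _) (ht := hb)
      (hμt := fun b => measure_ne_top _ _) hp (tendsto_measure_symmDiff_biUnion hs hd))
    refine key.congr fun b => ?_
    simp only [Function.comp]
    induction b using Finset.induction_on with
    | empty => simp [indicatorConstLp_empty]
    | insert a b ha ih =>
      rw [Finset.sum_insert ha, ← ih, ← map_add]
      congr 1
      rw [← indicatorConstLp_disjoint_union (hs a) (hb b)]
      · simp only [Finset.set_biUnion_insert]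
      · refine Set.disjoint_iUnion₂_right.2 fun i hi => hd ?_
        rintro rfl
        exact ha hi

lemma signedMeasureOfDual_apply {p : ENNReal} [Fact (1 ≤ p)] (hp : p ≠ ⊤)
    (φ : Lp ℝ p μ →L[ℝ] ℝ) {s : Set α} (hs : MeasurableSet s) :
    signedMeasureOfDual hp φ s = φ (indicatorConstLp p hs (measure_ne_top μ s) 1) :=
  dif_pos hs

/-- A continuous linear functional on `L_p` is given on indicators by an integrable density. -/
lemma exists_density_of_dual {p : ENNReal} [Fact (1 ≤ p)] (hp : p ≠ ⊤)
    (φ : Lp ℝ p μ →L[ℝ] ℝ) :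
    ∃ y : α → ℝ, Measurable y ∧ Integrable y μ ∧ ∀ (s : Set α) (hs : MeasurableSet s),
      φ (indicatorConstLp p hs (measure_ne_top μ s) 1) = ∫ t in s, y t ∂μ := by
  set ν := signedMeasureOfDual hp φ with hν
  refine ⟨ν.rnDeriv μ, SignedMeasure.measurable_rnDeriv _ _, SignedMeasure.integrable_rnDeriv _ _,
    fun s hs => ?_⟩
  rw [← withDensityᵥ_apply (SignedMeasure.integrable_rnDeriv _ _) hs,
    (SignedMeasure.absolutelyContinuous_iff_withDensityᵥ_rnDeriv_eq ν μ).1, hν,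
    signedMeasureOfDual_apply hp φ hs]
  -- Absolute continuity, needed for Radon–Nikodym: the indicator of a null set is zero in `L_p`.
  refine VectorMeasure.AbsolutelyContinuous.mk fun s hs h0 => ?_
  rw [Measure.toENNRealVectorMeasure_apply_measurable hs] at h0
  rw [hν, signedMeasureOfDual_apply hp φ hs]
  have : indicatorConstLp p hs (measure_ne_top μ s) (1 : ℝ) = 0 := by
    rw [← norm_eq_zero, norm_indicatorConstLp (zero_lt_one.trans_le Fact.out).ne' hp]
    rw [measureReal_def, h0]
    have : p.toReal ≠ 0 :=
      (ENNReal.toReal_pos (zero_lt_one.trans_le Fact.out).ne' hp).ne'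
    simp [Real.zero_rpow (inv_ne_zero this)]
  rw [this, map_zero]

/-- On a set where the density is bounded the functional is integration against the density. -/
lemma dual_apply_indicator_eq_integral {p q : ENNReal} [Fact (1 ≤ p)] (hp : p ≠ ⊤)
    [hpq : ENNReal.HolderConjugate p q] (φ : Lp ℝ p μ →L[ℝ] ℝ) {y : α → ℝ} (hy : Measurable y)
    (hφ : ∀ (s : Set α) (hs : MeasurableSet s),
      φ (indicatorConstLp p hs (measure_ne_top μ s) 1) = ∫ t in s, y t ∂μ)
    {E : Set α} (hE : MeasurableSet E) {C : ℝ} (hC : ∀ t ∈ E, |y t| ≤ C)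
    {v : α → ℝ} (hv : MemLp v p μ) :
    φ ((hv.indicator hE).toLp _) = ∫ t in E, y t * v t ∂μ := by
  have : ENNReal.HolderConjugate q p := hpq.symm
  have : Fact (1 ≤ q) := ⟨ENNReal.HolderConjugate.one_le q p⟩
  have hyE : MemLp (E.indicator y) q μ := by
    refine MemLp.of_bound (hy.indicator hE).aestronglyMeasurable (max C 0)
      (Eventually.of_forall fun t => ?_)
    by_cases ht : t ∈ E
    · simpa [ht] using Or.inl (hC t ht)
    · simp [ht]
  have hone : MemLp (E.indicator fun _ => (1 : ℝ)) ⊤ μ := (memLp_const 1).indicator hE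
  -- Both sides are continuous in `v`: `F₁` multiplies by `1_E ∈ L_∞` before applying `φ`, and `F₂`
  -- pairs with the bounded function `1_E y`. Agreement on indicators then suffices by density.
  let F₁ : Lp ℝ p μ →L[ℝ] ℝ :=
    φ.comp ((ContinuousLinearMap.mul ℝ ℝ).holderL μ ⊤ p p (hone.toLp _))
  let F₂ : Lp ℝ p μ →L[ℝ] ℝ := (ContinuousLinearMap.mul ℝ ℝ).lpPairing μ q p (hyE.toLp _)
  have h1 : ∀ {v : α → ℝ} (hv : MemLp v p μ), F₁ (hv.toLp _) = φ ((hv.indicator hE).toLp _) := by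
    intro v hv
    simp only [F₁, ContinuousLinearMap.comp_apply]
    congr 1
    refine Lp.ext ?_
    filter_upwards [ContinuousLinearMap.coeFn_holder (r := p) (ContinuousLinearMap.mul ℝ ℝ)
      (hone.toLp _) (hv.toLp _), hone.coeFn_toLp, hv.coeFn_toLp, (hv.indicator hE).coeFn_toLp]
      with t a b c d
    refine a.trans ?_
    rw [b, c, d]
    by_cases ht : t ∈ E <;> simp [ht]
  have h2 : ∀ {v : α → ℝ} (hv : MemLp v p μ), F₂ (hv.toLp _) = ∫ t in E, y t * v t ∂μ := by
    intro v hv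
    simp only [F₂]
    rw [ContinuousLinearMap.lpPairing_eq_integral, ← integral_indicator hE]
    refine integral_congr_ae ?_
    filter_upwards [hyE.coeFn_toLp, hv.coeFn_toLp] with t a b
    rw [a, b]
    by_cases ht : t ∈ E <;> simp [ht]
  rw [← h1 hv, ← h2 hv]
  generalize hv.toLp v = w
  induction w using Lp.induction hp with
  | indicatorConst c hs hμs =>
    rename_i s
    have hm : MemLp (s.indicator fun _ => c) p μ := (memLp_const c).indicator hs
    have e0 : ((Lp.simpleFunc.indicatorConst p hs hμs.ne c : Lp.simpleFunc ℝ p μ) : Lp ℝ p μ)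
        = hm.toLp _ := rfl
    rw [e0, h1 hm, h2 hm]
    have e1 : (hm.indicator hE).toLp _
        = c • indicatorConstLp p (hE.inter hs) (measure_ne_top μ _) (1 : ℝ) := by
      refine Lp.ext ?_
      filter_upwards [(hm.indicator hE).coeFn_toLp, Lp.coeFn_smul c
        (indicatorConstLp p (hE.inter hs) (measure_ne_top μ _) (1 : ℝ)),
        indicatorConstLp_coeFn (p := p) (hs := hE.inter hs) (hμs := measure_ne_top μ _)
          (c := (1 : ℝ))] with t a b d
      rw [a, b, Pi.smul_apply, d, Set.indicator_indicator]
      by_cases ht : t ∈ E ∩ s <;> simp [ht]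
    rw [e1, map_smul, hφ, ← setIntegral_indicator hs, smul_eq_mul, ← integral_const_mul]
    refine integral_congr_ae (Eventually.of_forall fun t => ?_)
    by_cases ht : t ∈ s <;> simp [ht, mul_comm]
  | add hf hg hd hf' hg' => rw [map_add, map_add, hf', hg']
  | isClosed => exact isClosed_eq F₁.continuous F₂.continuous

end RieszRepresentation

/-! ### The dual of `L_p` is `L_q` -/

section RieszRepresentation

open Filter Topology

lemma norm_toLp_eq_integral_rpow {α : Type*} [MeasurableSpace α] {μ : Measure α} {p : ENNReal} (hp0 : p ≠ 0) (hp : p ≠ ⊤) {v : α → ℝ}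
    (hv : MemLp v p μ) : ‖hv.toLp v‖ = (∫ t, |v t| ^ p.toReal ∂μ) ^ (p.toReal⁻¹) := by
  rw [Lp.norm_toLp, hv.eLpNorm_eq_integral_rpow_norm hp0 hp, ENNReal.toReal_ofReal]
  · simp only [Real.norm_eq_abs]
  · positivity

variable {α : Type*} [MeasurableSpace α] {μ : Measure α} [IsFiniteMeasure μ]

/-- The `L_q` norm of the density over a set where it is bounded is at most the norm of the
functional. -/
lemma eLpNorm_indicator_density_le {p q : ENNReal} [Fact (1 ≤ p)] (hp : p ≠ ⊤)
    [hpq : ENNReal.HolderConjugate p q] (φ : Lp ℝ p μ →L[ℝ] ℝ) {y : α → ℝ} (hy : Measurable y)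
    (hφ : ∀ (s : Set α) (hs : MeasurableSet s),
      φ (indicatorConstLp p hs (measure_ne_top μ s) 1) = ∫ t in s, y t ∂μ)
    {E : Set α} (hE : MeasurableSet E) {C : ℝ} (hC : ∀ t ∈ E, |y t| ≤ C) :
    eLpNorm (E.indicator y) q μ ≤ ENNReal.ofReal ‖φ‖ := by
  have hp1 : 1 ≤ p := Fact.out
  have hp0 : p ≠ 0 := (zero_lt_one.trans_le hp1).ne'
  let σ : α → ℝ := fun t => if y t < 0 then -1 else 1
  have hσm : Measurable σ :=
    Measurable.ite (measurableSet_lt hy measurable_const) measurable_const measurable_const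
  have hσ1 : ∀ t, |σ t| = 1 := fun t => by
    simp only [σ]; split_ifs <;> simp
  have hσy : ∀ t, y t * σ t = |y t| := fun t => by
    simp only [σ]
    split_ifs with h
    · rw [abs_of_neg h]; ring
    · rw [abs_of_nonneg (not_lt.1 h)]; ring
  by_cases hq : q = ⊤
  · subst hq
    have hp' : p = 1 := by
      have := hpq.inv_add_inv_eq_one
      simpa using this
    subst hp'
    rw [eLpNorm_exponent_top]
    refine eLpNormEssSup_le_of_ae_bound ?_
    have hint : Integrable (E.indicator y) μ := by
      refine Integrable.of_bound (hy.indicator hE).aestronglyMeasurable (max C 0)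
        (Eventually.of_forall fun t => ?_)
      by_cases ht : t ∈ E
      · simpa [ht] using Or.inl (hC t ht)
      · simp [ht]
    -- For `p = 1`, testing with the sign of `y` on `s` gives `∫_s |1_E y| ≤ ‖φ‖ μ(s)` for every
    -- measurable `s`.
    refine ae_le_of_forall_setIntegral_le hint.norm (integrable_const _) fun s hs _ => ?_
    have hv : MemLp (s.indicator σ) 1 μ :=
      MemLp.indicator hs (MemLp.of_bound hσm.aestronglyMeasurable 1
        (Eventually.of_forall fun t => (hσ1 t).le))
    have h1 := dual_apply_indicator_eq_integral (q := ⊤) hp φ hy hφ hE hC hv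
    have h2 := (le_abs_self _).trans (φ.le_opNorm ((hv.indicator hE).toLp _))
    rw [h1, norm_toLp_eq_integral_rpow hp0 hp] at h2
    have h3 : ∫ t in E, y t * s.indicator σ t ∂μ = ∫ t in s, ‖E.indicator y t‖ ∂μ := by
      rw [← integral_indicator hE, ← integral_indicator hs]
      refine integral_congr_ae (Eventually.of_forall fun t => ?_)
      by_cases ht : t ∈ E <;> by_cases ht' : t ∈ s <;> simp [ht, ht', hσy]
    rw [h3] at h2
    refine h2.trans ?_
    rw [integral_const, smul_eq_mul, mul_comm]
    refine mul_le_mul_of_nonneg_right ?_ (norm_nonneg _)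
    simp only [ENNReal.toReal_one, inv_one, Real.rpow_one]
    have h4 : ∫ t, |E.indicator (s.indicator σ) t| ∂μ ≤ ∫ t, s.indicator (fun _ => (1 : ℝ)) t ∂μ := by
      refine integral_mono_of_nonneg (Eventually.of_forall fun t => abs_nonneg _)
        ((integrable_const _).indicator hs) (Eventually.of_forall fun t => ?_)
      by_cases ht : t ∈ E <;> by_cases ht' : t ∈ s <;> simp [ht, ht', hσ1]
    refine h4.trans (le_of_eq ?_)
    rw [integral_indicator hs]
    simp
  · have hq1 : 1 ≤ q := by
      have := hpq.symm
      exact ENNReal.HolderConjugate.one_le q p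
    have hq0 : q ≠ 0 := (zero_lt_one.trans_le hq1).ne'
    have hr : p.toReal.HolderConjugate q.toReal := by
      exact ENNReal.HolderConjugate.toReal_of_ne_top hp hq
    set r := q.toReal with hrdef
    have hr1 : 0 < r - 1 := sub_pos.2 hr.symm.lt
    have hbd : MemLp (E.indicator y) q μ := by
      refine MemLp.of_bound (hy.indicator hE).aestronglyMeasurable (max C 0)
        (Eventually.of_forall fun t => ?_)
      by_cases ht : t ∈ E
      · simpa [ht] using Or.inl (hC t ht)
      · simp [ht]
    -- The extremal function of Hölder's inequality: on `E`, `y v = |v|^p = |y|^q`, so the norm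
    -- bound on `φ` reads `X ≤ ‖φ‖ X^(1/p)`.
    let v : α → ℝ := E.indicator fun t => σ t * |y t| ^ (r - 1)
    have hv : MemLp v p μ := by
      refine MemLp.of_bound ((hσm.mul (hy.abs.pow_const _)).indicator hE).aestronglyMeasurable
        ((max C 0) ^ (r - 1)) (Eventually.of_forall fun t => ?_)
      by_cases ht : t ∈ E
      · simp only [v, Set.indicator_of_mem ht, Real.norm_eq_abs, abs_mul, hσ1, one_mul]
        rw [abs_of_nonneg (by positivity)]
        exact Real.rpow_le_rpow (abs_nonneg _) ((hC t ht).trans (le_max_left _ _)) hr1.le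
      · simp only [v, Set.indicator_of_notMem ht, norm_zero]
        positivity
    have h1 := dual_apply_indicator_eq_integral (q := q) hp φ hy hφ hE hC hv
    have h2 := (le_abs_self _).trans (φ.le_opNorm ((hv.indicator hE).toLp _))
    rw [h1, norm_toLp_eq_integral_rpow hp0 hp] at h2
    set X := ∫ t, ‖E.indicator y t‖ ^ r ∂μ with hX
    have h3 : ∫ t in E, y t * v t ∂μ = X := by
      rw [← integral_indicator hE]
      refine integral_congr_ae (Eventually.of_forall fun t => ?_)
      by_cases ht : t ∈ E
      · simp only [v, Set.indicator_of_mem ht, Real.norm_eq_abs]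
        rw [← mul_assoc, hσy]
        nth_rewrite 1 [← Real.rpow_one |y t|]
        rw [← Real.rpow_add_of_nonneg (abs_nonneg _) zero_le_one hr1.le]
        congr 1; ring
      · simp [ht, Real.zero_rpow hr.symm.pos.ne']
    have h4 : ∫ t, |E.indicator v t| ^ p.toReal ∂μ = X := by
      refine integral_congr_ae (Eventually.of_forall fun t => ?_)
      by_cases ht : t ∈ E
      · simp only [v, Set.indicator_of_mem ht, Real.norm_eq_abs, abs_mul, hσ1, one_mul]
        rw [abs_of_nonneg (by positivity : 0 ≤ |y t| ^ (r - 1)), ← Real.rpow_mul (abs_nonneg _)]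
        congr 1
        exact hr.symm.sub_one_mul_conj
      · simp [ht, Real.zero_rpow hr.symm.pos.ne', Real.zero_rpow hr.pos.ne']
    rw [h3, h4] at h2
    rw [hbd.eLpNorm_eq_integral_rpow_norm hq0 hq]
    refine ENNReal.ofReal_le_ofReal ?_
    have hX0 : 0 ≤ X := integral_nonneg fun t => by positivity
    rcases hX0.eq_or_lt with h0 | h0
    · rw [← hrdef, ← hX, ← h0, Real.zero_rpow (inv_ne_zero hr.symm.pos.ne')]
      exact norm_nonneg _
    · have h5 : 0 < X ^ p.toReal⁻¹ := Real.rpow_pos_of_pos h0 _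
      have h6 : X ^ r⁻¹ * X ^ p.toReal⁻¹ = X := by
        rw [← Real.rpow_add h0, add_comm, hr.inv_add_inv_eq_one, Real.rpow_one]
      rw [← hrdef, ← hX]
      exact le_of_mul_le_mul_right (h6.le.trans h2) h5

/-- The dual of `L_p` of a finite measure is `L_q`. -/
theorem exists_lp_representation {p q : ENNReal} [Fact (1 ≤ p)] (hp : p ≠ ⊤)
    [hpq : ENNReal.HolderConjugate p q] (φ : Lp ℝ p μ →L[ℝ] ℝ) :
    ∃ y : Lp ℝ q μ, ∀ v : Lp ℝ p μ, φ v = ∫ t, y t * v t ∂μ := by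
  have : ENNReal.HolderConjugate q p := hpq.symm
  have : Fact (1 ≤ q) := ⟨ENNReal.HolderConjugate.one_le q p⟩
  obtain ⟨y, hy, hyi, hφ⟩ := exists_density_of_dual hp φ
  -- The truncations of `y` to these sets have `L_q` norm at most `‖φ‖`; Fatou's lemma passes the
  -- bound to `y`.
  let E : ℕ → Set α := fun k => {t | |y t| ≤ k}
  have hE : ∀ k, MeasurableSet (E k) := fun k => measurableSet_le hy.abs measurable_const
  have hlim : ∀ t, Tendsto (fun k => (E k).indicator y t) atTop (𝓝 (y t)) := by
    intro t
    obtain ⟨N, hN⟩ := exists_nat_ge |y t|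
    refine tendsto_const_nhds.congr' ?_
    filter_upwards [eventually_ge_atTop N] with k hk
    have : t ∈ E k := hN.trans (by exact_mod_cast hk)
    rw [Set.indicator_of_mem this]
  have hmem : MemLp y q μ := by
    refine ⟨hy.aestronglyMeasurable, ?_⟩
    have h1 := Lp.eLpNorm_lim_le_liminf_eLpNorm (p := q) (μ := μ)
      (fun k => (hy.indicator (hE k)).aestronglyMeasurable) y (Eventually.of_forall hlim)
    refine (h1.trans ?_).trans_lt (ENNReal.ofReal_lt_top (r := ‖φ‖))
    refine (liminf_le_liminf (Eventually.of_forall fun k =>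
      eLpNorm_indicator_density_le hp φ hy hφ (hE k) fun t ht => ht)).trans ?_
    simp
  refine ⟨hmem.toLp y, fun v => ?_⟩
  let F : Lp ℝ p μ →L[ℝ] ℝ := (ContinuousLinearMap.mul ℝ ℝ).lpPairing μ q p (hmem.toLp _)
  have hF : ∀ v, F v = ∫ t, hmem.toLp y t * v t ∂μ := fun v => by
    simp only [F]
    rw [ContinuousLinearMap.lpPairing_eq_integral]
    simp
  rw [← hF]
  induction v using Lp.induction hp with
  | indicatorConst c hs hμs =>
    rename_i s
    have e : ((Lp.simpleFunc.indicatorConst p hs hμs.ne c : Lp.simpleFunc ℝ p μ) : Lp ℝ p μ)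
        = c • indicatorConstLp p hs (measure_ne_top μ _) (1 : ℝ) := by
      rw [Lp.simpleFunc.coe_indicatorConst]
      refine Lp.ext ?_
      filter_upwards [indicatorConstLp_coeFn (p := p) (hs := hs) (hμs := measure_ne_top μ _)
        (c := c), Lp.coeFn_smul c (indicatorConstLp p hs (measure_ne_top μ _) (1 : ℝ)),
        indicatorConstLp_coeFn (p := p) (hs := hs) (hμs := measure_ne_top μ _)
          (c := (1 : ℝ))] with t a b d
      rw [a, b, Pi.smul_apply, d]
      by_cases ht : t ∈ s <;> simp [ht]
    rw [e, map_smul, map_smul, hφ, hF, ← integral_indicator hs]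
    congr 1
    refine integral_congr_ae ?_
    filter_upwards [hmem.coeFn_toLp, indicatorConstLp_coeFn (p := p) (hs := hs)
      (hμs := measure_ne_top μ _) (c := (1 : ℝ))] with t a b
    rw [a, b]
    by_cases ht : t ∈ s <;> simp [ht]
  | add hf hg hd hf' hg' => rw [map_add, map_add, hf', hg']
  | isClosed => exact isClosed_eq φ.continuous F.continuous

/-- The dual of `L_pⁿ` of a finite measure is `L_qⁿ`. -/
theorem exists_lp_representation_euclidean {p q : ENNReal} [Fact (1 ≤ p)] (hp : p ≠ ⊤)
    [hpq : ENNReal.HolderConjugate p q] {n : ℕ}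
    (φ : Lp (EuclideanSpace ℝ (Fin n)) p μ →L[ℝ] ℝ) :
    ∃ y : Lp (EuclideanSpace ℝ (Fin n)) q μ, ∀ v : Lp (EuclideanSpace ℝ (Fin n)) p μ,
      φ v = ∫ t, inner ℝ (y t) (v t) ∂μ := by
  have : ENNReal.HolderConjugate q p := hpq.symm
  have : Fact (1 ≤ q) := ⟨ENNReal.HolderConjugate.one_le q p⟩
  -- The scalar result is applied to `φ` restricted to each coordinate axis, and the densities are
  -- reassembled.
  let S : Fin n → ℝ →L[ℝ] EuclideanSpace ℝ (Fin n) := fun i =>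
    ContinuousLinearMap.toSpanSingleton ℝ (EuclideanSpace.single i 1)
  choose y hy using fun i => exists_lp_representation (q := q) hp (φ.comp ((S i).compLpL p μ))
  refine ⟨∑ i, (S i).compLpL q μ (y i), fun v => ?_⟩
  let π : Fin n → EuclideanSpace ℝ (Fin n) →L[ℝ] ℝ := fun i => EuclideanSpace.proj i
  have hv : v = ∑ i, (S i).compLpL p μ ((π i).compLpL p μ v) := by
    refine Lp.ext ?_
    have h1 := Lp.coeFn_finsetSum Finset.univ fun i => (S i).compLpL p μ ((π i).compLpL p μ v)
    have h2 : ∀ᵐ t ∂μ, ∀ i, (S i).compLpL p μ ((π i).compLpL p μ v) t = S i (v t i) := by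
      refine ae_all_iff.2 fun i => ?_
      filter_upwards [(S i).coeFn_compLpL ((π i).compLpL p μ v), (π i).coeFn_compLpL v] with t a b
      rw [a, b]; rfl
    filter_upwards [h1, h2] with t a b
    rw [a]
    simp only [Finset.sum_apply, b]
    ext j
    simp [S, Finset.sum_apply, Pi.single_apply]
  have hint : ∀ i, Integrable (fun t => y i t * v t i) μ := by
    intro i
    have := L1.integrable_coeFn ((ContinuousLinearMap.mul ℝ ℝ).holder 1 (y i) ((π i).compLpL p μ v))
    refine this.congr ?_
    filter_upwards [ContinuousLinearMap.coeFn_holder (r := 1) (ContinuousLinearMap.mul ℝ ℝ) (y i)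
      ((π i).compLpL p μ v), (π i).coeFn_compLpL v] with t a b
    rw [a, b]; rfl
  calc φ v = ∑ i, ∫ t, y i t * (π i).compLpL p μ v t ∂μ := by
        nth_rewrite 1 [hv]
        rw [map_sum]
        exact Finset.sum_congr rfl fun i _ => hy i _
    _ = ∑ i, ∫ t, y i t * v t i ∂μ := by
        refine Finset.sum_congr rfl fun i _ => integral_congr_ae ?_
        filter_upwards [(π i).coeFn_compLpL v] with t a
        rw [a]; rfl
    _ = ∫ t, ∑ i, y i t * v t i ∂μ := (integral_finsetSum _ fun i _ => hint i).symm
    _ = _ := by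
        refine integral_congr_ae ?_
        have h2 : ∀ᵐ t ∂μ, ∀ i, (S i).compLpL q μ (y i) t = S i (y i t) :=
          ae_all_iff.2 fun i => (S i).coeFn_compLpL (y i)
        filter_upwards [Lp.coeFn_finsetSum Finset.univ fun i => (S i).compLpL q μ (y i), h2]
          with t a b
        rw [a]
        simp only [Finset.sum_apply, b, sum_inner]
        refine Finset.sum_congr rfl fun i _ => ?_
        simp [S, inner_smul_left, EuclideanSpace.inner_single_left]

end RieszRepresentation

/-! ### One-sided directional derivatives of convex functions -/

section DirectionalDerivative

open Filter Topology Set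

variable {E : Type*} [NormedAddCommGroup E] [NormedSpace ℝ E]

/-- The one-sided directional derivative of `φ` at the origin in the direction `z`. -/
noncomputable def dirDerivZero (φ : E → ℝ) (z : E) : ℝ :=
  derivWithin (fun s : ℝ => φ (s • z)) (Ioi 0) 0

variable {φ : E → ℝ} {S : Set E}

/-- The restriction of `φ` to the line through `z` is convex with 0 interior to its domain, so its
right derivative exists there. -/
lemma ConvexOn.tendsto_dirDerivZero (hφ : ConvexOn ℝ S φ) (hS : S ∈ 𝓝 0) (h0 : φ 0 = 0) (z : E) :
    Tendsto (fun s : ℝ => s⁻¹ * φ (s • z)) (𝓝[>] 0) (𝓝 (dirDerivZero φ z)) := by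
  have h1 := hφ.comp_linearMap (LinearMap.toSpanSingleton ℝ E z)
  have h2 : (0 : ℝ) ∈ interior (LinearMap.toSpanSingleton ℝ E z ⁻¹' S) := by
    rw [mem_interior_iff_mem_nhds]
    have hc : ContinuousAt (fun s : ℝ => s • z) 0 := by fun_prop
    exact hc.preimage_mem_nhds (by simpa using hS)
  have h3 := (hasDerivWithinAt_iff_tendsto_slope' (by simp)).1
    (h1.hasDerivWithinAt_rightDeriv_of_mem_interior h2)
  refine h3.congr' (Eventually.of_forall fun s => ?_)
  simp [slope, h0]

/-- Since `s(z + w)` is the midpoint of `2sz` and `2sw`, convexity bounds its quotient by the sum of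
the quotients at step `2s`. -/
lemma ConvexOn.dirDerivZero_add_le (hφ : ConvexOn ℝ S φ) (hS : S ∈ 𝓝 0) (h0 : φ 0 = 0) (z w : E) :
    dirDerivZero φ (z + w) ≤ dirDerivZero φ z + dirDerivZero φ w := by
  have hd : Tendsto (fun s : ℝ => 2 * s) (𝓝[>] 0) (𝓝[>] 0) := by
    refine tendsto_nhdsWithin_iff.2 ⟨?_, ?_⟩
    · exact ((by fun_prop : Continuous fun s : ℝ => 2 * s).tendsto' 0 0 (by simp)).mono_left
        nhdsWithin_le_nhds
    · filter_upwards [self_mem_nhdsWithin] with s hs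
      exact mul_pos two_pos (mem_Ioi.1 hs)
  refine le_of_tendsto_of_tendsto (hφ.tendsto_dirDerivZero hS h0 (z + w))
    (((hφ.tendsto_dirDerivZero hS h0 z).comp hd).add
      ((hφ.tendsto_dirDerivZero hS h0 w).comp hd)) ?_
  have hev : ∀ z : E, ∀ᶠ s : ℝ in 𝓝[>] 0, (2 * s) • z ∈ S := fun z => by
    have hc : ContinuousAt (fun s : ℝ => (2 * s) • z) 0 := by fun_prop
    exact (hc.preimage_mem_nhds (by simpa using hS)) |> mem_nhdsWithin_of_mem_nhds
  filter_upwards [self_mem_nhdsWithin, hev z, hev w] with s hs hz hw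
  have hs : (0 : ℝ) < s := hs
  have h := hφ.2 hz hw (by norm_num : (0 : ℝ) ≤ 1 / 2) (by norm_num : (0 : ℝ) ≤ 1 / 2) (by norm_num)
  have e : (1 / 2 : ℝ) • (2 * s) • z + (1 / 2 : ℝ) • (2 * s) • w = s • (z + w) := by
    rw [smul_smul, smul_smul, smul_add]; congr 2 <;> ring
  rw [e] at h
  simp only [Function.comp, smul_eq_mul] at h ⊢
  calc s⁻¹ * φ (s • (z + w)) ≤ s⁻¹ * (1 / 2 * φ ((2 * s) • z) + 1 / 2 * φ ((2 * s) • w)) :=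
        mul_le_mul_of_nonneg_left h (inv_nonneg.2 hs.le)
    _ = _ := by rw [mul_inv]; ring

lemma ConvexOn.dirDerivZero_smul (hφ : ConvexOn ℝ S φ) (hS : S ∈ 𝓝 0) (h0 : φ 0 = 0) {c : ℝ}
    (hc : 0 < c) (z : E) : dirDerivZero φ (c • z) = c * dirDerivZero φ z := by
  have hd : Tendsto (fun s : ℝ => s * c) (𝓝[>] 0) (𝓝[>] 0) := by
    refine tendsto_nhdsWithin_iff.2 ⟨?_, ?_⟩
    · exact ((by fun_prop : Continuous fun s : ℝ => s * c).tendsto' 0 0 (by simp)).mono_left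
        nhdsWithin_le_nhds
    · filter_upwards [self_mem_nhdsWithin] with s hs
      exact mul_pos (mem_Ioi.1 hs) hc
  refine tendsto_nhds_unique (hφ.tendsto_dirDerivZero hS h0 (c • z))
    ((((hφ.tendsto_dirDerivZero hS h0 z).comp hd).const_mul c).congr fun s => ?_)
  simp only [Function.comp, smul_smul]
  field_simp

/-- Convexity on the segment from 0 to `z` bounds every quotient with `s < 1` by `φ z`. No smallness
of `z` is needed, which later makes the subgradient inequality global. -/
lemma ConvexOn.dirDerivZero_le (hφ : ConvexOn ℝ S φ) (hS : S ∈ 𝓝 0) (h0 : φ 0 = 0) {z : E}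
    (hz : z ∈ S) : dirDerivZero φ z ≤ φ z := by
  refine le_of_tendsto (hφ.tendsto_dirDerivZero hS h0 z) ?_
  filter_upwards [Ioo_mem_nhdsGT (zero_lt_one (α := ℝ))] with s hs
  have h := hφ.2 hz (mem_of_mem_nhds hS) hs.1.le (sub_nonneg.2 hs.2.le) (by ring)
  rw [smul_zero, add_zero, h0, smul_zero, add_zero, smul_eq_mul] at h
  rw [inv_mul_le_iff₀ hs.1]
  exact h

lemma ConvexOn.abs_dirDerivZero_le (hφ : ConvexOn ℝ S φ) (hS : S ∈ 𝓝 0) (h0 : φ 0 = 0) {K r : ℝ}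
    (hr : 0 < r) (hK : ∀ z, ‖z‖ ≤ r → |φ z| ≤ K * ‖z‖) (z : E) :
    |dirDerivZero φ z| ≤ K * ‖z‖ := by
  refine le_of_tendsto (hφ.tendsto_dirDerivZero hS h0 z).abs ?_
  have hc : Tendsto (fun s : ℝ => ‖s • z‖) (𝓝[>] 0) (𝓝 0) :=
    ((by fun_prop : Continuous fun s : ℝ => ‖s • z‖).tendsto' 0 0 (by simp)).mono_left
      nhdsWithin_le_nhds
  filter_upwards [self_mem_nhdsWithin, hc.eventually_le_const hr] with s hs hsr
  have hs : (0 : ℝ) < s := hs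
  rw [abs_mul, abs_inv, abs_of_pos hs, inv_mul_le_iff₀ hs]
  refine (hK _ hsr).trans (le_of_eq ?_)
  rw [norm_smul, Real.norm_eq_abs, abs_of_pos hs]; ring

end DirectionalDerivative

/-! ### Linear growth from the values at `± δ eᵢ` -/

section CrossPolytopeBound

/-- The growth constant of a function determined by its values at `± δ eᵢ`. -/
noncomputable def vertexBound {n : ℕ} (δ : ℝ) (φ : EuclideanSpace ℝ (Fin n) → ℝ) : ℝ :=
  δ⁻¹ * ∑ i, (|φ (δ • EuclideanSpace.single i 1)| + |φ (-δ • EuclideanSpace.single i 1)|)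

variable {n : ℕ} {φ : EuclideanSpace ℝ (Fin n) → ℝ} {S : Set (EuclideanSpace ℝ (Fin n))}

lemma vertexBound_nonneg {δ : ℝ} (hδ : 0 < δ) : 0 ≤ vertexBound δ φ := by
  unfold vertexBound; positivity

/-- The point `a • e` is a convex combination of 0 and the endpoint on its own side, with weight
`|a| / δ`. Adding both endpoint values makes the bound independent of the sign of `a`. -/
lemma ConvexOn.mem_and_le_axis {δ : ℝ} (hδ : 0 < δ) (hφ : ConvexOn ℝ S φ) (h0S : 0 ∈ S)
    (h0 : φ 0 = 0) {e : EuclideanSpace ℝ (Fin n)} (hp : δ • e ∈ S) (hm : -δ • e ∈ S) {a : ℝ}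
    (ha : |a| ≤ δ) : a • e ∈ S ∧ φ (a • e) ≤ |a| * (δ⁻¹ * (|φ (δ • e)| + |φ (-δ • e)|)) := by
  have key : ∀ b : ℝ, |b| = δ → b • e ∈ S → (|a| * δ⁻¹) * b = a →
      |φ (b • e)| ≤ |φ (δ • e)| + |φ (-δ • e)| →
      a • e ∈ S ∧ φ (a • e) ≤ |a| * (δ⁻¹ * (|φ (δ • e)| + |φ (-δ • e)|)) := by
    intro b hb hbS hab hle
    have hw : |a| * δ⁻¹ ≤ 1 := by
      rw [← div_eq_mul_inv, div_le_one hδ]; exact ha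
    have hw0 : 0 ≤ |a| * δ⁻¹ := by positivity
    have e1 : (|a| * δ⁻¹) • b • e + (1 - |a| * δ⁻¹) • (0 : EuclideanSpace ℝ (Fin n)) = a • e := by
      rw [smul_zero, add_zero, smul_smul, hab]
    refine ⟨e1 ▸ hφ.1 hbS h0S hw0 (sub_nonneg.2 hw) (by ring), ?_⟩
    have h := hφ.2 hbS h0S hw0 (sub_nonneg.2 hw) (by ring)
    rw [e1, h0, smul_zero, add_zero, smul_eq_mul] at h
    rw [← mul_assoc]
    exact h.trans (mul_le_mul_of_nonneg_left ((le_abs_self _).trans hle) hw0)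
  rcases le_total 0 a with h | h
  · refine key δ (abs_of_pos hδ) hp ?_ (le_add_of_nonneg_right (abs_nonneg _))
    rw [abs_of_nonneg h]; field_simp
  · refine key (-δ) (by rw [abs_neg, abs_of_pos hδ]) hm ?_ (le_add_of_nonneg_left (abs_nonneg _))
    rw [abs_of_nonpos h]; field_simp

/-- A convex function that vanishes at `0` and is finite at the points `± δ eᵢ` is finite and has
linear growth near `0`. -/
lemma ConvexOn.mem_and_abs_le_vertexBound {δ : ℝ} (hδ : 0 < δ) (hφ : ConvexOn ℝ S φ) (h0S : 0 ∈ S)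
    (h0 : φ 0 = 0) (hp : ∀ i, δ • EuclideanSpace.single i (1 : ℝ) ∈ S)
    (hm : ∀ i, -δ • EuclideanSpace.single i (1 : ℝ) ∈ S) {z : EuclideanSpace ℝ (Fin n)}
    (hz : n * ‖z‖ ≤ δ) : z ∈ S ∧ |φ z| ≤ vertexBound δ φ * ‖z‖ := by
  have upper : ∀ z : EuclideanSpace ℝ (Fin n), n * ‖z‖ ≤ δ →
      z ∈ S ∧ φ z ≤ vertexBound δ φ * ‖z‖ := by
    intro z hz
    rcases Nat.eq_zero_or_pos n with rfl | hn
    · have : z = 0 := Subsingleton.elim _ _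
      simp [this, h0S, h0]
    have hn' : (0 : ℝ) < n := by exact_mod_cast hn
    have hzi : ∀ i, |z i| ≤ ‖z‖ := fun i => by
      simpa using PiLp.norm_apply_le z i
    -- `z` is the average of the `n` axis points `n zᵢ eᵢ`, each within distance `δ` of 0.
    have hax : ∀ i, |n * z i| ≤ δ := fun i => by
      rw [abs_mul, abs_of_pos hn']
      exact (mul_le_mul_of_nonneg_left (hzi i) hn'.le).trans hz
    have H := fun i => hφ.mem_and_le_axis hδ h0S h0 (hp i) (hm i) (hax i)
    have hsum : ∑ _i : Fin n, (n : ℝ)⁻¹ = 1 := by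
      simp [hn'.ne']
    have e : ∑ i, (n : ℝ)⁻¹ • (n * z i) • EuclideanSpace.single i (1 : ℝ) = z := by
      ext j
      simp [Finset.sum_apply, Pi.single_apply, hn'.ne']
    have h1 := hφ.1.sum_mem (t := Finset.univ) (fun i _ => (inv_pos.2 hn').le) hsum
      fun i _ => (H i).1
    have h2 := hφ.map_sum_le (t := Finset.univ) (fun i _ => (inv_pos.2 hn').le) hsum
      fun i _ => (H i).1
    rw [e] at h1 h2
    refine ⟨h1, h2.trans ?_⟩
    rw [vertexBound, Finset.mul_sum, Finset.sum_mul]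
    refine Finset.sum_le_sum fun i _ => ?_
    rw [smul_eq_mul, inv_mul_le_iff₀ hn']
    refine (H i).2.trans ?_
    rw [abs_mul, abs_of_pos hn', mul_assoc, mul_comm _ ‖z‖]
    refine mul_le_mul_of_nonneg_left (mul_le_mul_of_nonneg_right (hzi i) (by positivity)) hn'.le
  obtain ⟨hzS, hzle⟩ := upper z hz
  obtain ⟨hzS', hzle'⟩ := upper (-z) (by rwa [norm_neg])
  refine ⟨hzS, abs_le.2 ⟨?_, hzle⟩⟩
  -- The lower bound: 0 is the midpoint of `z` and `-z`, so `0 ≤ φ z + φ (-z)`.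
  have h := hφ.2 hzS hzS' (by norm_num : (0 : ℝ) ≤ 1 / 2) (by norm_num : (0 : ℝ) ≤ 1 / 2)
    (by norm_num)
  rw [smul_neg, add_neg_cancel, h0, smul_eq_mul, smul_eq_mul] at h
  rw [norm_neg] at hzle'
  linarith

end CrossPolytopeBound

/-! ### From convex epigraphs to real convex functions -/

section ExtendedRealConvex

/-- The real part of an extended real-valued function with convex epigraph is convex on the
effective domain. -/
lemma convexOn_toReal_of_convex_epigraph {E : Type*} [AddCommGroup E] [Module ℝ E] {g : E → EReal}
    (hbot : ∀ x, g x ≠ ⊥) (hg : Convex ℝ (epigraph g)) :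
    ConvexOn ℝ {x | g x ≠ ⊤} fun x => (g x).toReal := by
  have key : ∀ x, g x ≠ ⊤ → ∀ y, g y ≠ ⊤ → ∀ a b : ℝ, 0 ≤ a → 0 ≤ b → a + b = 1 →
      g (a • x + b • y) ≤ ((a * (g x).toReal + b * (g y).toReal : ℝ) : EReal) := by
    intro x hx y hy a b ha hb hab
    have h1 : (x, (g x).toReal) ∈ epigraph g := (EReal.coe_toReal hx (hbot x)).ge
    have h2 : (y, (g y).toReal) ∈ epigraph g := (EReal.coe_toReal hy (hbot y)).ge
    exact hg h1 h2 ha hb hab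
  refine ⟨fun x hx y hy a b ha hb hab => ?_, fun x hx y hy a b ha hb hab => ?_⟩
  · exact ((key x hx y hy a b ha hb hab).trans_lt (EReal.coe_lt_top _)).ne
  · have h := key x hx y hy a b ha hb hab
    have h' := EReal.toReal_le_toReal h (hbot _) (EReal.coe_ne_top _)
    rwa [EReal.toReal_coe] at h'

end ExtendedRealConvex

/-! ### Hahn–Banach through a linear map -/

section SublinearExtension

/-- A linear functional on `V` dominated through a linear map `B : V → H` by a sublinear function
on `H` factors through a dominated linear functional on `H`. -/
lemma exists_linearMap_comp_eq_and_le {V H : Type*} [AddCommGroup V] [Module ℝ V] [AddCommGroup H]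
    [Module ℝ H] (B : V →ₗ[ℝ] H) (l : V →ₗ[ℝ] ℝ) (N : H → ℝ)
    (hsmul : ∀ c : ℝ, 0 < c → ∀ x, N (c • x) = c * N x) (hadd : ∀ x y, N (x + y) ≤ N x + N y)
    (hle : ∀ v, l v ≤ N (B v)) :
    ∃ g : H →ₗ[ℝ] ℝ, (∀ v, g (B v) = l v) ∧ ∀ x, g x ≤ N x := by
  have hN0 : N 0 = 0 := by
    have := hsmul 2 two_pos 0
    rw [smul_zero] at this
    linarith
  -- On the kernel both `l v` and `-l v` are at most `N 0 = 0`, so `l` descends to the range of `B`,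
  -- where dominated extension applies.
  have hker : l ∈ (LinearMap.ker B).dualAnnihilator := by
    rw [Submodule.mem_dualAnnihilator]
    intro v hv
    have h1 := hle v
    have h2 := hle (-v)
    rw [map_neg, map_neg, LinearMap.mem_ker.1 hv, neg_zero, hN0] at h2
    rw [LinearMap.mem_ker.1 hv, hN0] at h1
    linarith
  rw [← LinearMap.range_dualMap_eq_dualAnnihilator_ker] at hker
  obtain ⟨g₀, hg₀⟩ := hker
  have hg₀' : ∀ v, g₀ (B v) = l v := fun v => by rw [← hg₀]; rfl
  obtain ⟨g, hg, hgN⟩ := exists_extension_of_le_sublinear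
    ⟨LinearMap.range B, g₀.comp (LinearMap.range B).subtype⟩ N hsmul hadd (by
      rintro ⟨_, v, rfl⟩
      exact (hg₀' v).trans_le (hle v))
  exact ⟨g, fun v => (hg ⟨B v, v, rfl⟩).trans (hg₀' v), hgN⟩

end SublinearExtension

/-! ### Measurability of superpositions -/

section Superposition

open Filter Topology

variable {α : Type*} [MeasurableSpace α] {μ : Measure α}

/-- Superposition of a Carathéodory function with a measurable function. -/
lemma aestronglyMeasurable_superposition {E : Type*} [NormedAddCommGroup E] [MeasurableSpace E]
    [BorelSpace E] [SecondCountableTopology E] {h : α → E → ℝ} {s : Set E} {z₀ : E} (hz₀ : z₀ ∈ s)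
    (hm : ∀ z ∈ s, AEStronglyMeasurable (fun t => h t z) μ)
    (hc : ∀ᵐ t ∂μ, ContinuousOn (h t) s) {ξ : α → E} (hξ : Measurable ξ) (hξs : ∀ t, ξ t ∈ s) :
    AEStronglyMeasurable (fun t => h t (ξ t)) μ := by
  -- The approximants must take values in `s`, the only set where measurability and continuity of
  -- `h` are known.
  let σ : ℕ → SimpleFunc α E := SimpleFunc.approxOn ξ hξ s z₀ hz₀
  have hσ : ∀ k t, σ k t ∈ s := fun k t => SimpleFunc.approxOn_mem hξ hz₀ k t
  refine aestronglyMeasurable_of_tendsto_ae atTop (f := fun k t => h t (σ k t)) (fun k => ?_) ?_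
  · have e : (fun t => h t (σ k t))
        = fun t => ∑ c ∈ (σ k).range, (σ k ⁻¹' {c}).indicator (fun t => h t c) t := by
      funext t
      rw [Finset.sum_eq_single (σ k t)]
      · simp
      · intro c _ hct
        exact Set.indicator_of_notMem (fun hmem => hct hmem.symm) _
      · intro hnot
        exact absurd (SimpleFunc.mem_range_self _ t) hnot
    rw [e]
    refine Finset.aestronglyMeasurable_fun_sum _ fun c hcr => ?_
    obtain ⟨t, rfl⟩ := SimpleFunc.mem_range.1 hcr
    exact (hm _ (hσ k t)).indicator ((σ k).measurableSet_fiber _)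
  · filter_upwards [hc] with t ht
    have h1 : Tendsto (fun k => σ k t) atTop (𝓝[s] (ξ t)) :=
      tendsto_nhdsWithin_iff.2 ⟨SimpleFunc.tendsto_approxOn hξ hz₀ (subset_closure (hξs t)),
        Eventually.of_forall fun k => hσ k t⟩
    exact (ht (ξ t) (hξs t)).tendsto.comp h1

end Superposition

/-! ### Integrable representation of dominated functionals -/

section IntegralRepresentation

open Filter Topology

variable {α : Type*} [MeasurableSpace α] {μ : Measure α} [IsFiniteMeasure μ] {n : ℕ}

/-- Subadditivity gives `g z - g w ≤ g (z - w)`, so the growth constant is a Lipschitz constant. -/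
lemma continuous_of_sublinear_of_abs_le {E : Type*} [NormedAddCommGroup E] {g : E → ℝ}
    {K : ℝ} (hK : ∀ z, |g z| ≤ K * ‖z‖) (hadd : ∀ z w, g (z + w) ≤ g z + g w) : Continuous g := by
  have key : ∀ z w, g z - g w ≤ K * ‖z - w‖ := fun z w => by
    have h1 := hadd (z - w) w
    rw [sub_add_cancel] at h1
    linarith [(le_abs_self _).trans (hK (z - w))]
  have : LipschitzWith K.toNNReal g := by
    refine LipschitzWith.of_dist_le_mul fun z w => ?_
    rw [Real.dist_eq, dist_eq_norm]
    have h0 : K * ‖z - w‖ ≤ K.toNNReal * ‖z - w‖ :=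
      mul_le_mul_of_nonneg_right (Real.le_coe_toNNReal K) (norm_nonneg _)
    refine (abs_le.2 ⟨?_, key z w⟩).trans h0
    have := key w z
    rw [norm_sub_rev] at this
    linarith
  exact this.continuous

/-- A linear functional dominated by the integral of a sublinear integrand with integrable growth
is represented by an integrable selection of the subgradients of the integrand at the origin. -/
theorem exists_integrable_selection_of_le_integral [TopologicalSpace α] [BorelSpace α]
    [CompactSpace α] {V : Type*} [AddCommGroup V] [Module ℝ V] {g : α → RVec n → ℝ} {K : α → ℝ}
    (hK : Integrable K μ) (hg : ∀ z, AEStronglyMeasurable (fun t => g t z) μ)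
    (hgK : ∀ᵐ t ∂μ, ∀ z, |g t z| ≤ K t * ‖z‖)
    (hadd : ∀ᵐ t ∂μ, ∀ z w, g t (z + w) ≤ g t z + g t w)
    (hsmul : ∀ᵐ t ∂μ, ∀ c : ℝ, 0 < c → ∀ z, g t (c • z) = c * g t z)
    (A : V →ₗ[ℝ] C(α, RVec n)) (l : V →ₗ[ℝ] ℝ) (hl : ∀ v, l v ≤ ∫ t, g t (A v t) ∂μ) :
    ∃ u : Lp (RVec n) 1 μ, (∀ᵐ t ∂μ, ∀ z, inner ℝ (u t) z ≤ g t z) ∧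
      ∀ v, l v = ∫ t, inner ℝ (u t) (A v t) ∂μ := by
  have hcont : ∀ᵐ t ∂μ, Continuous (g t) := by
    filter_upwards [hgK, hadd] with t a b using continuous_of_sublinear_of_abs_le a b
  -- the weight `k = √(|K| + 1)`
  let k : α → ℝ := fun t => √(|K t| + 1)
  have hk1 : ∀ t, 1 ≤ k t := fun t => Real.one_le_sqrt.2 (by linarith [abs_nonneg (K t)])
  have hk0 : ∀ t, 0 < k t := fun t => zero_lt_one.trans_le (hk1 t)
  have hkk : ∀ t, k t * k t = |K t| + 1 := fun t => Real.mul_self_sqrt (by positivity)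
  have hkm : AEStronglyMeasurable k μ :=
    (Real.continuous_sqrt.comp_aestronglyMeasurable
      ((continuous_abs.comp_aestronglyMeasurable hK.1).add aestronglyMeasurable_const))
  have hk2 : MemLp k 2 μ := by
    rw [memLp_two_iff_integrable_sq hkm]
    refine (hK.abs.add (integrable_const 1)).congr (Eventually.of_forall fun t => ?_)
    simp [pow_two, hkk]
  let H := Lp (RVec n) 2 μ
  -- Dividing by `k` lowers the growth from `k²` to `k ∈ L₂`, which makes `N` bounded on `L₂`; the
  -- summand 1 in `k²` keeps `k` away from zero.
  have hbound : ∀ᵐ t ∂μ, ∀ z, |(k t)⁻¹ * g t z| ≤ k t * ‖z‖ := by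
    filter_upwards [hgK] with t ht z
    rw [abs_mul, abs_inv, abs_of_pos (hk0 t), inv_mul_le_iff₀ (hk0 t), ← mul_assoc, hkk]
    exact (ht z).trans (mul_le_mul_of_nonneg_right (by linarith [le_abs_self (K t)])
      (norm_nonneg _))
  have hint : ∀ ξ : H, Integrable (fun t => (k t)⁻¹ * g t (ξ t)) μ := by
    intro ξ
    have h1 : AEStronglyMeasurable (fun t => g t (ξ t)) μ :=
      aestronglyMeasurable_superposition (s := Set.univ) (Set.mem_univ 0) (fun z _ => hg z)
        (hcont.mono fun t ht => ht.continuousOn) (Lp.stronglyMeasurable ξ).measurable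
        fun t => Set.mem_univ _
    have h2 : Integrable (fun t => k t * ‖ξ t‖) μ := hk2.integrable_mul (Lp.memLp ξ).norm
    refine h2.mono (hkm.aemeasurable.inv.aestronglyMeasurable.mul h1) ?_
    filter_upwards [hbound] with t ht
    rw [Real.norm_eq_abs]
    exact (ht _).trans (le_abs_self _)
  let N : H → ℝ := fun ξ => ∫ t, (k t)⁻¹ * g t (ξ t) ∂μ
  have hNsmul : ∀ c : ℝ, 0 < c → ∀ ξ, N (c • ξ) = c * N ξ := by
    intro c hc ξ
    simp only [N]
    rw [← integral_const_mul]
    refine integral_congr_ae ?_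
    filter_upwards [Lp.coeFn_smul c ξ, hsmul] with t a b
    rw [a, Pi.smul_apply, b c hc]; ring
  have hNadd : ∀ ξ η, N (ξ + η) ≤ N ξ + N η := by
    intro ξ η
    simp only [N]
    rw [← integral_add (hint ξ) (hint η)]
    refine integral_mono_ae (hint _) ((hint ξ).add (hint η)) ?_
    filter_upwards [Lp.coeFn_add ξ η, hadd] with t a b
    rw [a, Pi.add_apply, ← mul_add]
    exact mul_le_mul_of_nonneg_left (b _ _) (inv_nonneg.2 (hk0 t).le)
  -- the embedding `v ↦ k A v` into `L₂`
  have hbase : ∀ x : C(α, RVec n), ((ContinuousLinearMap.lsmul ℝ ℝ).holderL μ 2 ⊤ 2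
      (hk2.toLp k) (ContinuousMap.toLp ⊤ μ ℝ x) : α → RVec n) =ᵐ[μ] fun t => k t • x t := by
    intro x
    filter_upwards [ContinuousLinearMap.coeFn_holder (r := 2)
      (ContinuousLinearMap.lsmul ℝ ℝ : ℝ →L[ℝ] RVec n →L[ℝ] RVec n)
      (hk2.toLp k) (ContinuousMap.toLp ⊤ μ ℝ x), hk2.coeFn_toLp,
      ContinuousMap.coeFn_toLp (p := ⊤) (𝕜 := ℝ) μ x] with t a b c
    refine a.trans ?_
    rw [b, c]; rfl
  let B : V →ₗ[ℝ] H := (((ContinuousLinearMap.lsmul ℝ ℝ).holderL μ 2 ⊤ 2 (hk2.toLp k)).comp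
    (ContinuousMap.toLp ⊤ μ ℝ) : C(α, RVec n) →L[ℝ] H).toLinearMap.comp A
  have hB : ∀ v, B v =ᵐ[μ] fun t => k t • A v t := fun v => hbase (A v)
  have hlN : ∀ v, l v ≤ N (B v) := by
    intro v
    refine (hl v).trans (le_of_eq (integral_congr_ae ?_))
    filter_upwards [hB v, hsmul] with t a b
    rw [a, b _ (hk0 t), inv_mul_cancel_left₀ (hk0 t).ne']
  obtain ⟨Λ, hΛ, hΛN⟩ := exists_linearMap_comp_eq_and_le B l N hNsmul hNadd hlN
  -- the extended functional is continuous on `L₂`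
  have hNle : ∀ ξ, N ξ ≤ ‖hk2.toLp k‖ * ‖ξ‖ := by
    intro ξ
    have h2 : Integrable (fun t => k t * ‖ξ t‖) μ := hk2.integrable_mul (Lp.memLp ξ).norm
    have h3 : N ξ ≤ ∫ t, k t * ‖ξ t‖ ∂μ := by
      refine integral_mono_ae (hint ξ) h2 ?_
      filter_upwards [hbound] with t ht
      exact (le_abs_self _).trans (ht _)
    refine h3.trans ?_
    have h4 := real_inner_le_norm (hk2.toLp k) ((Lp.memLp ξ).norm.toLp _)
    have h5 : ‖(Lp.memLp ξ).norm.toLp _‖ = ‖ξ‖ := by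
      rw [Lp.norm_toLp, eLpNorm_norm, ← Lp.norm_def]
    rw [h5, L2.inner_def] at h4
    refine le_trans (le_of_eq (integral_congr_ae ?_)) h4
    filter_upwards [hk2.coeFn_toLp, (Lp.memLp ξ).norm.coeFn_toLp] with t a b
    rw [a, b]
    simp [mul_comm]
  let Λ' : H →L[ℝ] ℝ := Λ.mkContinuous ‖hk2.toLp k‖ fun ξ => by
    rw [Real.norm_eq_abs]
    refine abs_le.2 ⟨?_, (hΛN ξ).trans (hNle ξ)⟩
    have := (hΛN (-ξ)).trans (hNle (-ξ))
    rw [map_neg, norm_neg] at this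
    linarith
  let w : H := (InnerProductSpace.toDual ℝ H).symm Λ'
  have hw : ∀ ξ : H, Λ ξ = ∫ t, inner ℝ (w t) (ξ t) ∂μ := fun ξ => by
    have : inner ℝ w ξ = Λ' ξ := InnerProductSpace.toDual_symm_apply
    rw [← L2.inner_def, this]
    rfl
  -- A product of two `L₂` functions, hence in `L₁`; moving `k` from `B v` onto `w` turns the
  -- representation on `L₂` into one against `A v`.
  let u : Lp (RVec n) 1 μ := (ContinuousLinearMap.lsmul ℝ ℝ).holder 1 (hk2.toLp k) w
  have hu : u =ᵐ[μ] fun t => k t • w t := by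
    filter_upwards [ContinuousLinearMap.coeFn_holder (r := 1)
      (ContinuousLinearMap.lsmul ℝ ℝ : ℝ →L[ℝ] RVec n →L[ℝ] RVec n) (hk2.toLp k) w,
      hk2.coeFn_toLp] with t a b
    refine a.trans ?_
    rw [b]; rfl
  refine ⟨u, ?_, fun v => ?_⟩
  · have hz : ∀ z : RVec n, ∀ᵐ t ∂μ, inner ℝ (w t) z ≤ (k t)⁻¹ * g t z := by
      intro z
      have hi1 : Integrable (fun t => inner ℝ (w t) z) μ :=
        ((Lp.memLp w).integrable one_le_two).inner_const z
      have hzm : MemLp (fun _ : α => z) 2 μ := memLp_const z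
      have hi2 : Integrable (fun t => (k t)⁻¹ * g t z) μ := by
        refine (hint (hzm.toLp _)).congr ?_
        filter_upwards [hzm.coeFn_toLp] with t a
        rw [a]
      -- Domination by `N` is localized by testing it on `1_s z` for each measurable `s`.
      refine ae_le_of_forall_setIntegral_le hi1 hi2 fun s hs _ => ?_
      have hsm : MemLp (s.indicator fun _ => z) 2 μ := hzm.indicator hs
      have h1 := hΛN (hsm.toLp _)
      rw [hw] at h1
      rw [← integral_indicator hs, ← integral_indicator hs]
      refine le_trans (le_of_eq ?_) (h1.trans (le_of_eq ?_))
      · refine integral_congr_ae ?_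
        filter_upwards [hsm.coeFn_toLp] with t a
        rw [a]
        by_cases ht : t ∈ s <;> simp [ht]
      · refine integral_congr_ae ?_
        filter_upwards [hsm.coeFn_toLp, hgK] with t a b
        rw [a]
        have h0 : g t 0 = 0 := by simpa using b 0
        by_cases ht : t ∈ s <;> simp [ht, h0]
    -- The exceptional null set depends on `z`; a countable dense set and continuity of `g t` give
    -- one null set for all `z`.
    obtain ⟨D, hDc, hDd⟩ := TopologicalSpace.exists_countable_dense (RVec n)
    have hD : ∀ᵐ t ∂μ, ∀ z ∈ D, inner ℝ (w t) z ≤ (k t)⁻¹ * g t z :=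
      (ae_ball_iff hDc).2 fun z _ => hz z
    filter_upwards [hD, hcont, hu] with t a b c z
    have hcl : IsClosed {z : RVec n | inner ℝ (w t) z ≤ (k t)⁻¹ * g t z} :=
      isClosed_le (by fun_prop) (by fun_prop)
    have hz' : z ∈ {z : RVec n | inner ℝ (w t) z ≤ (k t)⁻¹ * g t z} :=
      closure_minimal (fun z hz => a z hz) hcl (hDd z)
    rw [c, real_inner_smul_left]
    rw [Set.mem_ofPred_eq, le_inv_mul_iff₀ (hk0 t)] at hz'
    exact hz'
  · rw [← hΛ, hw]
    refine integral_congr_ae ?_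
    filter_upwards [hB v, hu] with t a b
    rw [a, b, real_inner_smul_left, real_inner_smul_right]

end IntegralRepresentation

/-! ### Extended integrals -/

section ExtIntegral

variable {α : Type*} [MeasurableSpace α] {μ : Measure α} {g : α → EReal} {h : α → ℝ}

lemma extIntegral_eq_integral (hh : Integrable h μ) (hg : ∀ᵐ t ∂μ, g t = (h t : EReal)) :
    extIntegral μ g = ((∫ t, h t ∂μ : ℝ) : EReal) := by
  have h1 : ∫⁻ t, (g t).toENNReal ∂μ = ∫⁻ t, ENNReal.ofReal (h t) ∂μ := by
    refine lintegral_congr_ae ?_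
    filter_upwards [hg] with t a
    rw [a]; simp
  have h2 : ∫⁻ t, (-g t).toENNReal ∂μ = ∫⁻ t, ENNReal.ofReal (-h t) ∂μ := by
    refine lintegral_congr_ae ?_
    filter_upwards [hg] with t a
    rw [a, ← EReal.coe_neg]; simp
  have f1 : ∫⁻ t, ENNReal.ofReal (h t) ∂μ ≠ ⊤ := hh.lintegral_lt_top.ne
  have f2 : ∫⁻ t, ENNReal.ofReal (-h t) ∂μ ≠ ⊤ := hh.neg.lintegral_lt_top.ne
  rw [extIntegral, h1, h2, if_neg f1, integral_eq_lintegral_pos_part_sub_lintegral_neg_part hh,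
    EReal.coe_sub, EReal.coe_ennreal_toReal f1, EReal.coe_ennreal_toReal f2]

/-- Positive and negative parts are compared separately, so `g` may be non-measurable or have `∫ g⁺
= +∞`. -/
lemma integral_le_extIntegral (hh : Integrable h μ) (hg : ∀ᵐ t ∂μ, (h t : EReal) ≤ g t) :
    ((∫ t, h t ∂μ : ℝ) : EReal) ≤ extIntegral μ g := by
  rw [← extIntegral_eq_integral (g := fun t => (h t : EReal)) hh
    (Filter.Eventually.of_forall fun _ => rfl)]
  unfold extIntegral
  have h1 : ∫⁻ t, ((h t : EReal)).toENNReal ∂μ ≤ ∫⁻ t, (g t).toENNReal ∂μ :=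
    lintegral_mono_ae (hg.mono fun t a => EReal.toENNReal_le_toENNReal a)
  have h2 : ∫⁻ t, (-g t).toENNReal ∂μ ≤ ∫⁻ t, (-(h t : EReal)).toENNReal ∂μ :=
    lintegral_mono_ae (hg.mono fun t a => EReal.toENNReal_le_toENNReal (EReal.neg_le_neg_iff.2 a))
  split_ifs with a b b
  · exact le_rfl
  · exact absurd (top_le_iff.1 (a ▸ h1)) b
  · exact le_top
  · exact EReal.sub_le_sub (EReal.coe_ennreal_le_coe_ennreal_iff.2 h1)
      (EReal.coe_ennreal_le_coe_ennreal_iff.2 h2)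

end ExtIntegral

/-! ### Growth and measurability of the increment -/

section IntegrandIncrement

open Filter Topology

/-- The increment `f(t, x(t) + z) - f(t, x(t))` of an integrand along `x`. -/
noncomputable def integrandIncrement {α : Type*} {n : ℕ} (f : α → RVec n → EReal) (x : α → RVec n)
    (t : α) (z : RVec n) : ℝ :=
  (f t (x t + z)).toReal - (f t (x t)).toReal

variable {α : Type*} {n : ℕ} {f : α → RVec n → EReal} {x : α → RVec n} {δ : ℝ}

lemma integrandIncrement_zero (t : α) : integrandIncrement f x t 0 = 0 := by
  simp [integrandIncrement]

lemma convexOn_integrandIncrement (hbot : ∀ t z, f t z ≠ ⊥)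
    (hconv : ∀ t, Convex ℝ (epigraph (f t))) (t : α) :
    ConvexOn ℝ {z | f t (x t + z) ≠ ⊤} (integrandIncrement f x t) := by
  have h1 := (convexOn_toReal_of_convex_epigraph (hbot t) (hconv t)).translate_right (x t)
  exact (h1.add_const (-(f t (x t)).toReal)).congr fun z _ => by
    simp [integrandIncrement, sub_eq_add_neg]

variable [MeasurableSpace α] {μ : Measure α}

lemma IsSummable.integrable_toReal {g : α → EReal} (hg : IsSummable μ g) :
    Integrable (fun t => (g t).toReal) μ := by
  obtain ⟨h, hh, hgh⟩ := hg
  refine hh.congr ?_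
  filter_upwards [hgh] with t a
  rw [a, EReal.toReal_coe]

lemma IsSummable.ae_ne_top {g : α → EReal} (hg : IsSummable μ g) : ∀ᵐ t ∂μ, g t ≠ ⊤ := by
  obtain ⟨h, -, hgh⟩ := hg
  filter_upwards [hgh] with t a
  rw [a]
  exact EReal.coe_ne_top _

lemma norm_smul_single {a : ℝ} (i : Fin n) : ‖a • EuclideanSpace.single i (1 : ℝ)‖ = |a| := by
  rw [norm_smul, PiLp.norm_single, norm_one, mul_one, Real.norm_eq_abs]

lemma integrable_integrandIncrement (hδ : 0 < δ)
    (hsum : ∀ z : RVec n, ‖z‖ ≤ δ → IsSummable μ fun t => f t (x t + z)) {z : RVec n}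
    (hz : ‖z‖ ≤ δ) : Integrable (fun t => integrandIncrement f x t z) μ := by
  have h0 := (hsum 0 (by simpa using hδ.le)).integrable_toReal
  simp only [add_zero] at h0
  exact (hsum z hz).integrable_toReal.sub h0

lemma integrable_vertexBound (hδ : 0 < δ)
    (hsum : ∀ z : RVec n, ‖z‖ ≤ δ → IsSummable μ fun t => f t (x t + z)) :
    Integrable (fun t => vertexBound δ (integrandIncrement f x t)) μ := by
  refine Integrable.const_mul (integrable_finsetSum _ fun i _ => ?_) _
  exact (integrable_integrandIncrement hδ hsum
      (by rw [norm_smul_single, abs_of_pos hδ])).abs.add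
    (integrable_integrandIncrement hδ hsum
      (by rw [norm_smul_single, abs_neg, abs_of_pos hδ])).abs

/-- Finiteness is needed only at 0 and `± δ eᵢ`, so a single null set serves all `z`. The radius `δ
/ (n + 1)` also covers `n = 0`. -/
lemma ae_abs_integrandIncrement_le (hbot : ∀ t z, f t z ≠ ⊥)
    (hconv : ∀ t, Convex ℝ (epigraph (f t))) (hδ : 0 < δ)
    (hsum : ∀ z : RVec n, ‖z‖ ≤ δ → IsSummable μ fun t => f t (x t + z)) :
    ∀ᵐ t ∂μ, ∀ z : RVec n, ‖z‖ ≤ δ / (n + 1) → f t (x t + z) ≠ ⊤ ∧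
      |integrandIncrement f x t z| ≤ vertexBound δ (integrandIncrement f x t) * ‖z‖ := by
  have h0 := (hsum 0 (by simpa using hδ.le)).ae_ne_top
  have hp : ∀ᵐ t ∂μ, ∀ i : Fin n, f t (x t + δ • EuclideanSpace.single i (1 : ℝ)) ≠ ⊤ :=
    ae_all_iff.2 fun i => (hsum _ (by rw [norm_smul_single, abs_of_pos hδ])).ae_ne_top
  have hm : ∀ᵐ t ∂μ, ∀ i : Fin n, f t (x t + -δ • EuclideanSpace.single i (1 : ℝ)) ≠ ⊤ :=
    ae_all_iff.2 fun i => (hsum _ (by rw [norm_smul_single, abs_neg, abs_of_pos hδ])).ae_ne_top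
  filter_upwards [h0, hp, hm] with t a b c z hz
  refine (convexOn_integrandIncrement hbot hconv t).mem_and_abs_le_vertexBound hδ a
    (integrandIncrement_zero t) b c ?_
  rw [le_div_iff₀ (by positivity)] at hz
  linarith [norm_nonneg z]

lemma ae_domain_mem_nhds (hbot : ∀ t z, f t z ≠ ⊥)
    (hconv : ∀ t, Convex ℝ (epigraph (f t))) (hδ : 0 < δ)
    (hsum : ∀ z : RVec n, ‖z‖ ≤ δ → IsSummable μ fun t => f t (x t + z)) :
    ∀ᵐ t ∂μ, {z | f t (x t + z) ≠ ⊤} ∈ 𝓝 (0 : RVec n) := by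
  filter_upwards [ae_abs_integrandIncrement_le hbot hconv hδ hsum] with t a
  filter_upwards [Metric.closedBall_mem_nhds (0 : RVec n)
    (by positivity : 0 < δ / ((n : ℝ) + 1))] with z hz
  exact (a z (by simpa using hz)).1

lemma aestronglyMeasurable_dirDerivZero_increment (hbot : ∀ t z, f t z ≠ ⊥)
    (hconv : ∀ t, Convex ℝ (epigraph (f t))) (hδ : 0 < δ)
    (hsum : ∀ z : RVec n, ‖z‖ ≤ δ → IsSummable μ fun t => f t (x t + z)) (z : RVec n) :
    AEStronglyMeasurable (fun t => dirDerivZero (integrandIncrement f x t) z) μ := by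
  -- This scale keeps every `s k • z` in the ball of radius `δ`, where the increments are
  -- integrable; the derivative is then a limit of a sequence of measurable functions.
  let c : ℝ := δ / (‖z‖ + 1)
  have hc : 0 < c := by positivity
  let s : ℕ → ℝ := fun k => c * (1 / ((k : ℝ) + 1))
  have hs0 : ∀ k, 0 < s k := fun k => by positivity
  have hsc : ∀ k, s k ≤ c := fun k =>
    mul_le_of_le_one_right hc.le ((div_le_one (by positivity)).2 (by linarith [k.cast_nonneg (α := ℝ)]))
  have hs : Tendsto s atTop (𝓝[>] 0) := by
    refine tendsto_nhdsWithin_iff.2 ⟨?_, Eventually.of_forall hs0⟩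
    simpa [s] using (tendsto_one_div_add_atTop_nhds_zero_nat (𝕜 := ℝ)).const_mul c
  refine aestronglyMeasurable_of_tendsto_ae atTop
    (f := fun k t => (s k)⁻¹ * integrandIncrement f x t (s k • z)) (fun k => ?_) ?_
  · refine (integrable_integrandIncrement hδ hsum ?_).1.const_mul _
    rw [norm_smul, Real.norm_eq_abs, abs_of_pos (hs0 k)]
    refine (mul_le_mul_of_nonneg_right (hsc k) (norm_nonneg z)).trans ?_
    rw [div_mul_eq_mul_div, div_le_iff₀ (by positivity)]
    nlinarith [norm_nonneg z]
  · filter_upwards [ae_domain_mem_nhds hbot hconv hδ hsum] with t a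
    exact ((convexOn_integrandIncrement hbot hconv t).tendsto_dirDerivZero a
      (integrandIncrement_zero t) z).comp hs

/-- A finite convex function on an open ball is continuous, so the increment is Carathéodory there;
hence the strict inequality on `ξ`. -/
lemma aestronglyMeasurable_integrandIncrement_comp (hbot : ∀ t z, f t z ≠ ⊥)
    (hconv : ∀ t, Convex ℝ (epigraph (f t))) (hδ : 0 < δ)
    (hsum : ∀ z : RVec n, ‖z‖ ≤ δ → IsSummable μ fun t => f t (x t + z)) {ξ : α → RVec n}
    (hξ : Measurable ξ) (hξr : ∀ t, ‖ξ t‖ < δ / (n + 1)) :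
    AEStronglyMeasurable (fun t => integrandIncrement f x t (ξ t)) μ := by
  have hr : 0 < δ / ((n : ℝ) + 1) := by positivity
  have hrδ : δ / ((n : ℝ) + 1) ≤ δ :=
    div_le_self hδ.le (by linarith [n.cast_nonneg (α := ℝ)])
  refine aestronglyMeasurable_superposition (s := Metric.ball 0 (δ / ((n : ℝ) + 1)))
    (Metric.mem_ball_self hr) (fun z hz => ?_) ?_ hξ fun t => by simpa using hξr t
  · exact (integrable_integrandIncrement hδ hsum
      ((mem_ball_zero_iff.1 hz).le.trans hrδ)).1
  · filter_upwards [ae_abs_integrandIncrement_le hbot hconv hδ hsum] with t a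
    exact ((convexOn_integrandIncrement hbot hconv t).subset
      (fun z hz => (a z (mem_ball_zero_iff.1 hz).le).1) (convex_ball _ _)).continuousOn
      Metric.isOpen_ball

end IntegrandIncrement

/-! ### From the integral functional to pointwise subgradients -/

section IntegralFunctionalSubgradient

open Filter Topology

variable {α : Type*} [MeasurableSpace α] {μ : Measure α} [TopologicalSpace α]
  [BorelSpace α] [CompactSpace α] {n : ℕ} {f : α → RVec n → EReal} {x : α → RVec n} {δ : ℝ}

/-- A lower bound for all increments of the integral functional in the direction `y` is a lower
bound for its directional derivative. -/
lemma le_integral_dirDerivZero (hbot : ∀ t z, f t z ≠ ⊥)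
    (hconv : ∀ t, Convex ℝ (epigraph (f t))) (hδ : 0 < δ)
    (hsum : ∀ z : RVec n, ‖z‖ ≤ δ → IsSummable μ fun t => f t (x t + z)) (y : C(α, RVec n)) {c : ℝ}
    (hc : ∀ s : ℝ, 0 < s → extIntegral μ (fun t => f t (x t)) + ((s * c : ℝ) : EReal)
      ≤ extIntegral μ fun t => f t (x t + s • y t)) :
    c ≤ ∫ t, dirDerivZero (integrandIncrement f x t) (y t) ∂μ := by
  have h0 := hsum 0 (by simpa using hδ.le)
  simp only [add_zero] at h0
  have hK := integrable_vertexBound hδ hsum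
  have hgr := ae_abs_integrandIncrement_le hbot hconv hδ hsum
  have hr : 0 < δ / ((n : ℝ) + 1) := by positivity
  have hsmall : ∀ᶠ s : ℝ in 𝓝[>] 0, 0 < s ∧ ∀ t, ‖s • y t‖ < δ / (n + 1) := by
    have h1 : Tendsto (fun s : ℝ => ‖s • y‖) (𝓝[>] 0) (𝓝 0) :=
      ((by fun_prop : Continuous fun s : ℝ => ‖s • y‖).tendsto' 0 0
        (by rw [zero_smul ℝ y, norm_zero])).mono_left
        nhdsWithin_le_nhds
    filter_upwards [self_mem_nhdsWithin, h1.eventually_lt_const hr] with s hs hsr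
    exact ⟨hs, fun t => ((s • y).norm_coe_le_norm t).trans_lt hsr⟩
  have hmeas : ∀ s : ℝ, (∀ t, ‖s • y t‖ < δ / (n + 1)) →
      AEStronglyMeasurable (fun t => integrandIncrement f x t (s • y t)) μ := fun s hs =>
    aestronglyMeasurable_integrandIncrement_comp hbot hconv hδ hsum
      (s • y).continuous.measurable hs
  have hbd : ∀ s : ℝ, 0 < s → (∀ t, ‖s • y t‖ < δ / (n + 1)) →
      ∀ᵐ t ∂μ, ‖s⁻¹ * integrandIncrement f x t (s • y t)‖
        ≤ vertexBound δ (integrandIncrement f x t) * ‖y‖ := by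
    intro s hs hsr
    filter_upwards [hgr] with t a
    rw [norm_mul, norm_inv, Real.norm_eq_abs, Real.norm_eq_abs, abs_of_pos hs,
      inv_mul_le_iff₀ hs]
    refine (a _ (hsr t).le).2.trans ?_
    rw [norm_smul, Real.norm_eq_abs, abs_of_pos hs, mul_left_comm]
    exact mul_le_mul_of_nonneg_left (mul_le_mul_of_nonneg_left (y.norm_coe_le_norm t)
      (vertexBound_nonneg hδ)) hs.le
  have hlim : Tendsto (fun s : ℝ => ∫ t, s⁻¹ * integrandIncrement f x t (s • y t) ∂μ) (𝓝[>] 0)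
      (𝓝 (∫ t, dirDerivZero (integrandIncrement f x t) (y t) ∂μ)) := by
    -- The quotients are dominated by `K(t) ‖y‖`, with `K` the integrable vertex bound.
    refine tendsto_integral_filter_of_dominated_convergence
      (fun t => vertexBound δ (integrandIncrement f x t) * ‖y‖) ?_ ?_ (hK.mul_const _) ?_
    · filter_upwards [hsmall] with s hs using (hmeas s hs.2).const_mul _
    · filter_upwards [hsmall] with s hs using hbd s hs.1 hs.2
    · filter_upwards [ae_domain_mem_nhds hbot hconv hδ hsum] with t a
      exact (convexOn_integrandIncrement hbot hconv t).tendsto_dirDerivZero a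
        (integrandIncrement_zero t) (y t)
  refine ge_of_tendsto hlim ?_
  filter_upwards [hsmall] with s hs
  have hi1 : Integrable (fun t => s⁻¹ * integrandIncrement f x t (s • y t)) μ :=
    (hK.mul_const ‖y‖).mono' ((hmeas s hs.2).const_mul _) (hbd s hs.1 hs.2)
  have hi : Integrable (fun t => integrandIncrement f x t (s • y t)) μ := by
    refine (hi1.const_mul s).congr (Eventually.of_forall fun t => ?_)
    exact mul_inv_cancel_left₀ hs.1.ne' _
  have e1 := extIntegral_eq_integral h0.integrable_toReal (h0.ae_ne_top.mono fun t a =>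
    (EReal.coe_toReal a (hbot t _)).symm)
  have e2 : extIntegral μ (fun t => f t (x t + s • y t)) = ((∫ t, ((f t (x t)).toReal
      + integrandIncrement f x t (s • y t)) ∂μ : ℝ) : EReal) := by
    refine extIntegral_eq_integral (h0.integrable_toReal.add hi) ?_
    filter_upwards [hgr] with t a
    rw [integrandIncrement, add_sub_cancel, EReal.coe_toReal (a _ (hs.2 t).le).1 (hbot t _)]
  have h := hc s hs.1
  rw [e1, e2, integral_add h0.integrable_toReal hi, ← EReal.coe_add, EReal.coe_le_coe_iff,
    add_le_add_iff_left] at h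
  rw [integral_const_mul, le_inv_mul_iff₀ hs.1]
  exact h

/-- A functional dominated by the directional derivative of the integral functional is represented
by an integrable selection of the subdifferentials of the integrand. -/
lemma exists_subgradient_selection [IsFiniteMeasure μ] (hbot : ∀ t z, f t z ≠ ⊥)
    (hconv : ∀ t, Convex ℝ (epigraph (f t))) (hδ : 0 < δ)
    (hsum : ∀ z : RVec n, ‖z‖ ≤ δ → IsSummable μ fun t => f t (x t + z))
    {V : Type*} [AddCommGroup V] [Module ℝ V] (A : V →ₗ[ℝ] C(α, RVec n)) (l : V →ₗ[ℝ] ℝ)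
    (hl : ∀ v, l v ≤ ∫ t, dirDerivZero (integrandIncrement f x t) (A v t) ∂μ) :
    ∃ u : Lp (RVec n) 1 μ, (∀ᵐ t ∂μ, u t ∈ subdifferential (inner ℝ) (f t) (x t)) ∧
      ∀ v, l v = ∫ t, inner ℝ (u t) (A v t) ∂μ := by
  have hdom := ae_domain_mem_nhds hbot hconv hδ hsum
  have hcv := fun t => convexOn_integrandIncrement (x := x) hbot hconv t
  have hz := fun t => integrandIncrement_zero (f := f) (x := x) t
  have hgr := ae_abs_integrandIncrement_le hbot hconv hδ hsum
  obtain ⟨u, hu, hul⟩ := exists_integrable_selection_of_le_integral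
    (g := fun t => dirDerivZero (integrandIncrement f x t))
    (integrable_vertexBound hδ hsum)
    (aestronglyMeasurable_dirDerivZero_increment hbot hconv hδ hsum)
    (by
      filter_upwards [hdom, hgr] with t a b z
      exact (hcv t).abs_dirDerivZero_le a (hz t) (by positivity : 0 < δ / ((n : ℝ) + 1))
        (fun z hz => (b z hz).2) z)
    (by
      filter_upwards [hdom] with t a z w
      exact (hcv t).dirDerivZero_add_le a (hz t) z w)
    (by
      filter_upwards [hdom] with t a c hc z
      exact (hcv t).dirDerivZero_smul a (hz t) hc z) A l hl
  refine ⟨u, ?_, hul⟩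
  filter_upwards [hdom, hu] with t a b
  have h0 : f t (x t) ≠ ⊤ := by simpa using mem_of_mem_nhds a
  refine ⟨hbot t _, h0, fun z => ?_⟩
  by_cases hzt : f t z = ⊤
  · rw [hzt]; exact le_top
  -- `u t` is a subgradient of the derivative at 0, and the derivative lies below the increment on
  -- its whole effective domain.
  have hm : z - x t ∈ {z | f t (x t + z) ≠ ⊤} := by simpa using hzt
  have h1 := (b (z - x t)).trans ((hcv t).dirDerivZero_le a (hz t) hm)
  rw [integrandIncrement, add_sub_cancel] at h1
  rw [← EReal.coe_toReal h0 (hbot t _), ← EReal.coe_toReal hzt (hbot t _), ← EReal.coe_add,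
    EReal.coe_le_coe_iff]
  linarith

end IntegralFunctionalSubgradient

instance isFiniteMeasure_lebIcc (t₀ T : ℝ) : IsFiniteMeasure (lebIcc t₀ T) := by
  have : IsFiniteMeasureOnCompacts (lebIcc t₀ T) :=
    IsFiniteMeasureOnCompacts.comap' volume continuous_subtype_val
      (MeasurableEmbedding.subtype_coe measurableSet_Icc)
  infer_instance

/-! ### Adjoint images and the subdifferential formula -/

section MainTheorem

variable {n : ℕ} {t₀ T : ℝ} {p q : ENNReal}

/-- The pairing with a fixed element of `L_qⁿ` as a linear functional on `L_pⁿ`. -/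
lemma exists_linearMap_eq_lpPair [Fact (1 ≤ p)] (hpq : ENNReal.HolderConjugate p q)
    (y : LpVec n t₀ T q) : ∃ l : LpVec n t₀ T p →ₗ[ℝ] ℝ, ∀ v, l v = lpPair y v := by
  have : ENNReal.HolderConjugate q p := hpq.symm
  have : Fact (1 ≤ q) := ⟨ENNReal.HolderConjugate.one_le q p⟩
  exact ⟨((innerSL ℝ).lpPairing (lebIcc t₀ T) q p y).toLinearMap, fun v =>
    (innerSL ℝ).lpPairing_eq_integral y v⟩

lemma integrable_inner_continuousMap (u : LpVec n t₀ T 1) (x : CVec n t₀ T) :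
    Integrable (fun t => inner ℝ (u t) (x t)) (lebIcc t₀ T) := by
  refine (L1.integrable_coeFn ((innerSL ℝ).holder 1 u
    (ContinuousMap.toLp ⊤ (lebIcc t₀ T) ℝ x))).congr ?_
  filter_upwards [(innerSL ℝ).coeFn_holder (r := 1) u (ContinuousMap.toLp ⊤ (lebIcc t₀ T) ℝ x),
    ContinuousMap.coeFn_toLp (p := ⊤) (𝕜 := ℝ) (lebIcc t₀ T) x] with t a b
  rw [a, b]; rfl

/-- Every `u ∈ L_1ⁿ`, regarded as a functional on `Cⁿ`, has an adjoint image in `L_qⁿ`. -/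
lemma exists_isAdjointImage [Fact (1 ≤ p)] (hp : p ≠ ⊤) (hpq : ENNReal.HolderConjugate p q)
    (A : LpVec n t₀ T p →L[ℝ] CVec n t₀ T) (u : LpVec n t₀ T 1) :
    ∃ y : LpVec n t₀ T q, IsAdjointImage A u y := by
  -- `v ↦ ∫ (u | Av)` is continuous on `L_p` as the composite of `A`, the inclusion `C → L_∞` and
  -- the pairing with `u ∈ L₁`.
  let φ : LpVec n t₀ T p →L[ℝ] ℝ := (((innerSL ℝ).lpPairing (lebIcc t₀ T) 1 ⊤ u).comp
    (ContinuousMap.toLp ⊤ (lebIcc t₀ T) ℝ)).comp A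
  obtain ⟨y, hy⟩ := exists_lp_representation_euclidean (q := q) hp φ
  refine ⟨y, fun v => (hy v).symm.trans ?_⟩
  refine ((innerSL ℝ).lpPairing_eq_integral u _).trans (integral_congr_ae ?_)
  filter_upwards [ContinuousMap.coeFn_toLp (p := ⊤) (𝕜 := ℝ) (lebIcc t₀ T) (A v)] with t a
  exact congrArg (inner ℝ (u t)) a

/-- Adjoint images of selections of the subdifferentials of the integrand are subgradients of the
integral functional. -/
lemma mem_subdifferential_integralFunctional [Fact (1 ≤ p)]
    {f : Set.Icc t₀ T → RVec n → EReal} {A : LpVec n t₀ T p →L[ℝ] CVec n t₀ T}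
    {u₀ : LpVec n t₀ T p} (h0 : IsSummable (lebIcc t₀ T) fun t => f t (A u₀ t))
    {u : LpVec n t₀ T 1}
    (hu : ∀ᵐ t ∂lebIcc t₀ T, u t ∈ subdifferential (inner ℝ) (f t) (A u₀ t))
    {y : LpVec n t₀ T q} (hy : IsAdjointImage A u y) :
    y ∈ subdifferential (lpPair (q := q)) (integralFunctional f A) u₀ := by
  obtain ⟨h, hh, hgh⟩ := h0
  have e : integralFunctional f A u₀ = _ := extIntegral_eq_integral hh hgh
  refine ⟨e ▸ EReal.coe_ne_bot _, e ▸ EReal.coe_ne_top _, fun v => ?_⟩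
  have hi := integrable_inner_continuousMap u (A (v - u₀))
  rw [e, hy, ← EReal.coe_add, ← integral_add hh hi]
  refine integral_le_extIntegral (hh.add hi) ?_
  filter_upwards [hu, hgh] with t a b
  have := a.2.2 (A v t)
  rw [b, ← EReal.coe_add] at this
  simpa [map_sub] using this

theorem mainTheorem3 {n : ℕ} {t₀ T : ℝ} (hT : t₀ < T)
    {p q : ENNReal} [Fact (1 ≤ p)] (hp : p ≠ ⊤) (hpq : ENNReal.HolderConjugate p q)
    (f : Set.Icc t₀ T → RVec n → EReal) (hf : IsNormalConvexIntegrand f)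
    (A : LpVec n t₀ T p →L[ℝ] CVec n t₀ T) (hA : IsCompactOperator A)
    (u₀ : LpVec n t₀ T p)
    (hsum : ∃ δ : ℝ, 0 < δ ∧ ∀ x : RVec n, ‖x‖ ≤ δ →
      IsSummable (lebIcc t₀ T) fun t => f t (A u₀ t + x)) :
    (subdifferential (lpPair (q := q)) (integralFunctional f A) u₀).Nonempty ∧
    ∀ y : LpVec n t₀ T q,
      y ∈ subdifferential (lpPair (q := q)) (integralFunctional f A) u₀ ↔
        ∃ u : LpVec n t₀ T 1,
          (∀ᵐ t ∂lebIcc t₀ T, u t ∈ subdifferential (inner ℝ) (f t) (A u₀ t)) ∧ IsAdjointImage A u y := by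
  obtain ⟨δ, hδ, hsum⟩ := hsum
  have h0 := hsum 0 (by simpa using hδ.le)
  simp only [add_zero] at h0
  refine ⟨?_, fun y => ⟨fun hy => ?_, fun ⟨u, hu, huy⟩ =>
    mem_subdifferential_integralFunctional h0 hu huy⟩⟩
  -- With the trivial space and zero maps the domination hypothesis is `0 ≤ 0`, so only the
  -- existence of an integrable selection remains.
  · obtain ⟨u, hu, -⟩ := exists_subgradient_selection (V := Fin 0 → ℝ) hf.ne_bot
      hf.convex_epigraph hδ hsum 0 0 fun v => by
        simp [dirDerivZero]
    obtain ⟨y, hy⟩ := exists_isAdjointImage hp hpq A u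
    exact ⟨y, mem_subdifferential_integralFunctional h0 hu hy⟩
  · obtain ⟨l, hl⟩ := exists_linearMap_eq_lpPair hpq y
    obtain ⟨u, hu, hul⟩ := exists_subgradient_selection hf.ne_bot hf.convex_epigraph hδ hsum
      A.toLinearMap l fun v => by
        refine le_integral_dirDerivZero hf.ne_bot hf.convex_epigraph hδ hsum (A v) fun s _ => ?_
        -- The subgradient inequality along the ray `ū + sv` bounds `J` from below with slope `l v`.
        have h := hy.2.2 (u₀ + s • v)
        rw [add_sub_cancel_left, ← hl, map_smul] at h
        simpa [integralFunctional] using h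
    exact ⟨u, hu, fun v => (hl v).symm.trans (hul v)⟩

end MainTheorem
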